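/- Let $n\ge 1$, let $q_0,\dots,q_n\in\mathbb R^n$ be the vertices of an $n$-simplex all of whose sides have length one, let $F_i(x)=\frac12(x+q_i)$ for $0\le i\le n$, and let the Sierpinski $n$-gasket $S_n$ be the unique nonempty compact set with $S_n=\bigcup_{i}F_i(S_n)$. For a finite word $w=w_1\cdots w_k$ over $\{0,\dots,n\}$ put $F_w=F_{w_1}\circ\cdots\circ F_{w_k}$; the set $F_w(S_n)$ is a $k$-level cell and its boundary points are $F_w(q_0),\dots,F_w(q_n)$. Let $\mu_n$ be the standard measure on $S_n$, i.e. the Borel probability measure with $\mu_n(X)=\sum_{i=0}^n\frac1{n+1}\mu_n(F_i^{-1}(X))$, and let $\nu_n$ be the pushforward of $\mu_n$ under the barycentric coordinate $x\mapsto [x]_0$, where $x=\sum_i[x]_iq_i$, $\sum_i[x]_i=1$. A path from $x$ to $y$ is a continuous $\gamma:[0,1]\to S_n$ with $\gamma(0)=x$, $\gamma(1)=y$; its length is $|\gamma|=\mathcal H^1(\gamma([0,1]))$, and $d(x,y)$ is the infimum of the lengths of all paths from $x$ to $y$. A geodesic from $x$ to $y$ is a path $\gamma$ from $x$ to $y$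 of length $d(x,y)$ parametrized at constant speed: $\mathcal H^1(\gamma([0,t]))=t|\gamma|$ for $t\in[0,1]$. A common path from $A\subseteq S_n$ to $B\subseteq S_n$ is a path $\hat\gamma$ in $S_n$ of finite length and constant speed such that for all $a\in A$, $b\in B$ there are a geodesic $\hat\gamma_{a\to b}$ from $a$ to $b$ and an entry time $t_1$ and an exit time $t_2$, $0\le t_1\le t_2\le 1$, with $\hat\gamma(u)=\hat\gamma_{a\to b}(t_1+u(t_2-t_1))$ for $u\in[0,1]$. Let $t_1^f$ be the supremum of all entry times and $t_2^i$ the infimum of all exit times over $a\in A$, $b\in B$. The common path $\hat\gamma$ is regular if it is maximal under inclusion of images among the common paths from $A$ to $B$ and $t_1^f<t_2^i$. Theorem. Let $A$ be a $k$-level cell and $B$ an $m$-level cell joined by a regular common path $\hat\gamma$ from $A$ to $B$ that is the unique geodesic from a boundary point $\dot a$ of $A$ to a boundary point $\dot b$ of $B$. For each $(a,b)\in A\times B$ let $\hat\gamma_{a\to b}$ be any geodesic from $a$ to $b$ that contains $\hat\gamma$ as above, and put $Z_t(a,b)=\hat\gamma_{a\to b}(t)$. Let $t\in[t_1^f,t_2^i]$.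 Then there is an interval $I_t=[\alpha,\beta]\subseteq[0,1]$ with $Z_t(A,B)=\hat\gamma(I_t)$, where $\alpha$ and $\beta$ are the infimum and the supremum of $\{s\in[0,1]:\hat\gamma(s)\in Z_t(A,B)\}$; let $H_t:[0,1]\to Z_t(A,B)$, $H_t(s)=\hat\gamma(\alpha+s(\beta-\alpha))$, and let $\psi_t:[0,1]\times[0,1]\to[0,1]$, $$\psi_t(s,r)=\frac{2^{-k}(1-t)s+2^{-m}t(1-r)}{2^{-k}(1-t)+2^{-m}t}.$$ Moreover $Z_t$ is measurable on $A\times B$ (up to null sets of $\mu_n\times\mu_n$), $H_t$ is measurable up to null sets of $(\nu_n\times\nu_n)\circ\psi_t^{-1}$, and the interpolating measure $\eta_t(X)=(\mu_n\times\mu_n)(\{(a,b)\in A\times B: Z_t(a,b)\in X\})$ ($X$ Borel) is $$\eta_t=(n+1)^{-k-m}\,(\nu_n\times\nu_n)\circ\psi_t^{-1}\circ H_t^{-1}.$$ -/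

import Mathlib

open MeasureTheory Set
open scoped ENNReal

noncomputable section

namespace SierpinskiGasket

/-- The vertices `q 0, …, q n` of an `n`-simplex in `ℝⁿ` are given as an affine basis of `ℝⁿ`, so that
`q.coord i` is the `i`-th barycentric coordinate. -/
abbrev Vertices (n : ℕ) : Type := AffineBasis (Fin (n + 1)) ℝ (EuclideanSpace ℝ (Fin n))

variable {n : ℕ} (q : Vertices n)

/-- All sides of the simplex have length one. -/
def UnitSides : Prop := ∀ i j, i ≠ j → dist (q i) (q j) = 1

/-! ### The iterated function system, its attractor and its cells -/

/-- The contraction `F_i(x) = (x + q_i) / 2`. -/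
def contraction (i : Fin (n + 1)) (x : EuclideanSpace ℝ (Fin n)) : EuclideanSpace ℝ (Fin n) :=
  (1 / 2 : ℝ) • (x + q i)

/-- `F_w = F_{w_1} ∘ ⋯ ∘ F_{w_m}` for a finite address `w = w_1 ⋯ w_m`. -/
def wordMap : List (Fin (n + 1)) → EuclideanSpace ℝ (Fin n) → EuclideanSpace ℝ (Fin n)
  | [], x => x
  | i :: w, x => contraction q i (wordMap w x)

/-- The point with infinite address `w_1 w_2 ⋯`, that is, `∑_j 2^{-j} q_{w_j}` (`j ≥ 1`). -/
def addressPoint (w : ℕ → Fin (n + 1)) : EuclideanSpace ℝ (Fin n) :=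
  ∑' j, (1 / 2 : ℝ) ^ (j + 1) • q (w j)

/-- The Sierpinski `n`-gasket `S_n`: the set of all points that have an infinite address.  It is the
unique nonempty compact attractor of the contractions, see `gasket_isCompact`, `gasket_nonempty`,
`gasket_eq_iUnion` and `eq_gasket`. -/
def gasket : Set (EuclideanSpace ℝ (Fin n)) := range (addressPoint q)

/-- The cell `⟨w⟩ = F_w(S_n)`; its level is the length of `w`. -/
def cell (w : List (Fin (n + 1))) : Set (EuclideanSpace ℝ (Fin n)) := wordMap q w '' gasket q

/-- The boundary point `⟨w i i i ⋯⟩ = F_w(q_i)` of the cell `⟨w⟩`. -/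
def boundaryPoint (w : List (Fin (n + 1))) (i : Fin (n + 1)) : EuclideanSpace ℝ (Fin n) :=
  wordMap q w (q i)

/-! ### The standard measure and its barycentric projection -/

/-- The uniform probability measure on the alphabet `{0, …, n}`. -/
def letterMeasure (n : ℕ) : Measure (Fin (n + 1)) := (PMF.uniformOfFintype (Fin (n + 1))).toMeasure

instance : IsProbabilityMeasure (letterMeasure n) := by
  unfold letterMeasure; infer_instance

/-- Infinite addresses with independent uniformly distributed letters. -/
def addressMeasure (n : ℕ) : Measure (ℕ → Fin (n + 1)) := Measure.infinitePi fun _ => letterMeasure n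

instance : IsProbabilityMeasure (addressMeasure n) := by
  unfold addressMeasure; infer_instance

/-- The standard measure `μ_n` on `S_n`: the law of the point with a uniformly random address.
It is the self-similar probability measure with weights `1 / (n + 1)`, see
`stdMeasure_selfSimilar`. -/
def stdMeasure : Measure (EuclideanSpace ℝ (Fin n)) := (addressMeasure n).map (addressPoint q)

/-- `ν_n`, the pushforward of `μ_n` under the barycentric coordinate `x ↦ [x]_0`. -/
def baryMeasure : Measure ℝ := (stdMeasure q).map (q.coord 0)

/-! ### Paths, intrinsic metric, geodesics -/

/-- `γ`, restricted to `[0,1]`, is a path in `S_n` from `x` to `y`. -/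
def IsPath (γ : ℝ → EuclideanSpace ℝ (Fin n)) (x y : EuclideanSpace ℝ (Fin n)) : Prop :=
  ContinuousOn γ (Icc 0 1) ∧ MapsTo γ (Icc 0 1) (gasket q) ∧ γ 0 = x ∧ γ 1 = y

/-- The length of a path: the one-dimensional Hausdorff measure of its image. -/
def pathLength (γ : ℝ → EuclideanSpace ℝ (Fin n)) : ℝ≥0∞ := Measure.hausdorffMeasure 1 (γ '' Icc 0 1)

/-- The intrinsic metric of `S_n`: the infimum of the lengths of all paths from `x` to `y`. -/
def intrinsicDist (x y : EuclideanSpace ℝ (Fin n)) : ℝ≥0∞ :=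
  ⨅ (γ : ℝ → EuclideanSpace ℝ (Fin n)) (_ : IsPath q γ x y), pathLength γ

/-- Parametrization at constant speed: `H¹(γ([0,t])) = t |γ|` for all `t ∈ [0,1]`. -/
def HasConstantSpeed (γ : ℝ → EuclideanSpace ℝ (Fin n)) : Prop :=
  ∀ t ∈ Icc (0 : ℝ) 1, Measure.hausdorffMeasure 1 (γ '' Icc 0 t) = ENNReal.ofReal t * pathLength γ

/-- A geodesic from `x` to `y`: a length minimizing path, parametrized at constant speed. -/
def IsGeodesic (γ : ℝ → EuclideanSpace ℝ (Fin n)) (x y : EuclideanSpace ℝ (Fin n)) : Prop :=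
  IsPath q γ x y ∧ HasConstantSpeed γ ∧ pathLength γ = intrinsicDist q x y

/-- `γ` is, as a path parametrized on `[0,1]`, the only geodesic from `x` to `y`. -/
def IsUniqueGeodesic (γ : ℝ → EuclideanSpace ℝ (Fin n)) (x y : EuclideanSpace ℝ (Fin n)) : Prop :=
  IsGeodesic q γ x y ∧ ∀ γ', IsGeodesic q γ' x y → EqOn γ' γ (Icc 0 1)

/-! ### Common paths -/

/-- The path `σ` is the piece of `γ` between the entry time `t₁` and the exit time `t₂`. -/
def IsPiece (σ γ : ℝ → EuclideanSpace ℝ (Fin n)) (t₁ t₂ : ℝ) : Prop :=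
  0 ≤ t₁ ∧ t₁ ≤ t₂ ∧ t₂ ≤ 1 ∧ ∀ u ∈ Icc (0 : ℝ) 1, σ u = γ (t₁ + u * (t₂ - t₁))

/-- `σ` is a common path from `A` to `B`: a path of finite length in `S_n` such that for all `a ∈ A`
and `b ∈ B` some geodesic from `a` to `b` contains `σ` as a piece. -/
def IsCommonPath (A B : Set (EuclideanSpace ℝ (Fin n))) (σ : ℝ → EuclideanSpace ℝ (Fin n)) : Prop :=
  IsPath q σ (σ 0) (σ 1) ∧ pathLength σ < ∞ ∧ HasConstantSpeed σ ∧
    ∀ a ∈ A, ∀ b ∈ B, ∃ γ t₁ t₂, IsGeodesic q γ a b ∧ IsPiece σ γ t₁ t₂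

/-- The set of all entry times of `σ`. -/
def entryTimes (A B : Set (EuclideanSpace ℝ (Fin n))) (σ : ℝ → EuclideanSpace ℝ (Fin n)) : Set ℝ :=
  {t₁ | ∃ a ∈ A, ∃ b ∈ B, ∃ γ t₂, IsGeodesic q γ a b ∧ IsPiece σ γ t₁ t₂}

/-- The set of all exit times of `σ`. -/
def exitTimes (A B : Set (EuclideanSpace ℝ (Fin n))) (σ : ℝ → EuclideanSpace ℝ (Fin n)) : Set ℝ :=
  {t₂ | ∃ a ∈ A, ∃ b ∈ B, ∃ γ t₁, IsGeodesic q γ a b ∧ IsPiece σ γ t₁ t₂}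

/-- The final entry time `t_1^f`. -/
def finalEntryTime (A B : Set (EuclideanSpace ℝ (Fin n))) (σ : ℝ → EuclideanSpace ℝ (Fin n)) : ℝ :=
  sSup (entryTimes q A B σ)

/-- The initial exit time `t_2^i`. -/
def initialExitTime (A B : Set (EuclideanSpace ℝ (Fin n))) (σ : ℝ → EuclideanSpace ℝ (Fin n)) : ℝ :=
  sInf (exitTimes q A B σ)

/-- A regular common path: a common path that is maximal under inclusion (of images) and satisfies
`t_1^f < t_2^i`. -/
def IsRegularCommonPath (A B : Set (EuclideanSpace ℝ (Fin n)))
    (σ : ℝ → EuclideanSpace ℝ (Fin n)) : Prop :=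
  IsCommonPath q A B σ ∧
    (∀ σ', IsCommonPath q A B σ' → σ '' Icc 0 1 ⊆ σ' '' Icc 0 1 → σ' '' Icc 0 1 = σ '' Icc 0 1) ∧
    finalEntryTime q A B σ < initialExitTime q A B σ

/-! ### Interpolation along a common path -/

/-- `G` selects for all `a ∈ A` and `b ∈ B` a geodesic from `a` to `b` that contains `σ`. -/
def IsGeodesicSelection (A B : Set (EuclideanSpace ℝ (Fin n))) (σ : ℝ → EuclideanSpace ℝ (Fin n))
    (G : EuclideanSpace ℝ (Fin n) → EuclideanSpace ℝ (Fin n) → ℝ → EuclideanSpace ℝ (Fin n)) : Prop :=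
  ∀ a ∈ A, ∀ b ∈ B, IsGeodesic q (G a b) a b ∧ ∃ t₁ t₂, IsPiece σ (G a b) t₁ t₂

/-- The interpolant `Z_t`, as a map of pairs `(a, b)`: the point at time `t` on the selected geodesic. -/
def interpolant
    (G : EuclideanSpace ℝ (Fin n) → EuclideanSpace ℝ (Fin n) → ℝ → EuclideanSpace ℝ (Fin n)) (t : ℝ)
    (p : EuclideanSpace ℝ (Fin n) × EuclideanSpace ℝ (Fin n)) : EuclideanSpace ℝ (Fin n) :=
  G p.1 p.2 t

/-- The product measure `μ_n × μ_n` on `A × B`. -/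
def pairMeasure (A B : Set (EuclideanSpace ℝ (Fin n))) :
    Measure (EuclideanSpace ℝ (Fin n) × EuclideanSpace ℝ (Fin n)) :=
  ((stdMeasure q).prod (stdMeasure q)).restrict (A ×ˢ B)

/-- The interpolating measure `η_t`: the pushforward under `Z_t` of `μ_n × μ_n` on `A × B`. -/
def interpolatingMeasure (A B : Set (EuclideanSpace ℝ (Fin n)))
    (G : EuclideanSpace ℝ (Fin n) → EuclideanSpace ℝ (Fin n) → ℝ → EuclideanSpace ℝ (Fin n)) (t : ℝ) :
    Measure (EuclideanSpace ℝ (Fin n)) :=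
  (pairMeasure q A B).map (interpolant G t)

/-- `I_t`: the parameters in `[0,1]` of the points of the path `σ` that lie in `Z`. -/
def paramSet (σ : ℝ → EuclideanSpace ℝ (Fin n)) (Z : Set (EuclideanSpace ℝ (Fin n))) : Set ℝ :=
  {s | s ∈ Icc (0 : ℝ) 1 ∧ σ s ∈ Z}

/-- `H`: the increasing linear map that takes `0` and `1` to the endpoints of the interval of
parameters of `Z`, followed by `σ`. -/
def linearParam (σ : ℝ → EuclideanSpace ℝ (Fin n)) (Z : Set (EuclideanSpace ℝ (Fin n))) (s : ℝ) :
    EuclideanSpace ℝ (Fin n) :=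
  σ (sInf (paramSet σ Z) + s * (sSup (paramSet σ Z) - sInf (paramSet σ Z)))

/-- The map `ψ_t(s, r)` for cells of levels `k` and `m`. -/
def squareMap (k m : ℕ) (t : ℝ) (p : ℝ × ℝ) : ℝ :=
  ((1 / 2) ^ k * (1 - t) * p.1 + (1 / 2) ^ m * t * (1 - p.2)) /
    ((1 / 2) ^ k * (1 - t) + (1 / 2) ^ m * t)

/-! ### The gasket is the attractor and the standard measure is self-similar -/

/-- The address `i w_1 w_2 ⋯`. -/
def consAddress (i : Fin (n + 1)) (w : ℕ → Fin (n + 1)) : ℕ → Fin (n + 1)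
  | 0 => i
  | j + 1 => w j

theorem exists_norm_le : ∃ C, ∀ i, ‖q i‖ ≤ C :=
  ⟨∑ i, ‖q i‖, fun i => Finset.single_le_sum (f := fun i => ‖q i‖)
    (fun _ _ => norm_nonneg _) (Finset.mem_univ i)⟩

theorem summable_geom (C : ℝ) : Summable fun j : ℕ => (1 / 2 : ℝ) ^ (j + 1) * C :=
  ((summable_nat_add_iff 1).2 summable_geometric_two).mul_right C

theorem norm_term_le {C : ℝ} (hC : ∀ i, ‖q i‖ ≤ C) (w : ℕ → Fin (n + 1)) (j : ℕ) :
    ‖(1 / 2 : ℝ) ^ (j + 1) • q (w j)‖ ≤ (1 / 2 : ℝ) ^ (j + 1) * C := by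
  rw [norm_smul, Real.norm_of_nonneg (by positivity)]
  exact mul_le_mul_of_nonneg_left (hC _) (by positivity)

theorem summable_address (w : ℕ → Fin (n + 1)) :
    Summable fun j : ℕ => (1 / 2 : ℝ) ^ (j + 1) • q (w j) := by
  obtain ⟨C, hC⟩ := exists_norm_le q
  exact Summable.of_norm_bounded (summable_geom C) (norm_term_le q hC w)

theorem addressPoint_cons (i : Fin (n + 1)) (w : ℕ → Fin (n + 1)) :
    addressPoint q (consAddress i w) = contraction q i (addressPoint q w) := by
  unfold addressPoint contraction
  rw [(summable_address q _).tsum_eq_zero_add, smul_add, ← tsum_const_smul'' (1 / 2 : ℝ), add_comm]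
  simp only [consAddress, smul_smul]
  congr 1
  · congr 1; ext1 j; rw [pow_succ' _ (j + 1)]
  · simp

theorem addressPoint_continuous : Continuous (addressPoint q) := by
  obtain ⟨C, hC⟩ := exists_norm_le q
  refine continuous_tsum (fun j => ?_) (summable_geom C) (fun j w => norm_term_le q hC w j)
  have h : Continuous fun i : Fin (n + 1) => (1 / 2 : ℝ) ^ (j + 1) • q i :=
    continuous_of_discreteTopology
  exact h.comp (continuous_apply j)

theorem gasket_isCompact : IsCompact (gasket q) :=
  isCompact_range (addressPoint_continuous q)

theorem gasket_nonempty : (gasket q).Nonempty := range_nonempty _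

theorem consAddress_tail (w : ℕ → Fin (n + 1)) : consAddress (w 0) (fun j => w (j + 1)) = w := by
  funext j; cases j <;> rfl

theorem gasket_eq_iUnion : gasket q = ⋃ i, contraction q i '' gasket q := by
  ext x
  simp only [gasket, mem_range, mem_iUnion, mem_image, exists_exists_eq_and]
  constructor
  · rintro ⟨w, rfl⟩
    exact ⟨w 0, fun j => w (j + 1), by rw [← addressPoint_cons, consAddress_tail]⟩
  · rintro ⟨i, w, rfl⟩
    exact ⟨_, addressPoint_cons q i w⟩

theorem dist_contraction (i : Fin (n + 1)) (x y : EuclideanSpace ℝ (Fin n)) :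
    dist (contraction q i x) (contraction q i y) = 1 / 2 * dist x y := by
  unfold contraction
  rw [dist_smul₀, dist_add_right, Real.norm_of_nonneg (by norm_num)]

/-- One inclusion of the uniqueness of compact attractors. -/
theorem attractor_subset {K L : Set (EuclideanSpace ℝ (Fin n))} (hK : IsCompact K)
    (hL : IsCompact L) (hL0 : L.Nonempty) (hKe : K = ⋃ i, contraction q i '' K)
    (hLe : L = ⋃ i, contraction q i '' L) : K ⊆ L := by
  rcases K.eq_empty_or_nonempty with rfl | hK0
  · exact empty_subset _
  obtain ⟨x, hx, hmax⟩ := hK.exists_isMaxOn hK0 (Metric.continuous_infDist_pt L).continuousOn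
  have hx' : x ∈ ⋃ i, contraction q i '' K := hKe ▸ hx
  obtain ⟨i, y, hy, rfl⟩ := by simpa only [mem_iUnion, mem_image] using hx'
  obtain ⟨z, hz, hyz⟩ := hL.exists_infDist_eq_dist hL0 y
  have hz' : contraction q i z ∈ L := by
    rw [hLe]; exact mem_iUnion.2 ⟨i, mem_image_of_mem _ hz⟩
  have h1 := Metric.infDist_le_dist_of_mem (x := contraction q i y) hz'
  rw [dist_contraction, ← hyz] at h1
  have h2 : Metric.infDist y L ≤ Metric.infDist (contraction q i y) L := hmax hy
  have h3 : Metric.infDist (contraction q i y) L ≤ 0 := by linarith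
  intro u hu
  have h4 : Metric.infDist u L ≤ Metric.infDist (contraction q i y) L := hmax hu
  exact (hL.isClosed.mem_iff_infDist_zero hL0).2
    (le_antisymm (h4.trans h3) Metric.infDist_nonneg)

/-- The gasket is the only nonempty compact attractor. -/
theorem eq_gasket {K : Set (EuclideanSpace ℝ (Fin n))} (hK : IsCompact K) (hK0 : K.Nonempty)
    (hKe : K = ⋃ i, contraction q i '' K) : K = gasket q :=
  (attractor_subset q hK (gasket_isCompact q) (gasket_nonempty q) hKe (gasket_eq_iUnion q)).antisymm
    (attractor_subset q (gasket_isCompact q) hK hK0 (gasket_eq_iUnion q) hKe)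

theorem measurable_consAddress (i : Fin (n + 1)) : Measurable (consAddress i) := by
  refine measurable_pi_lambda _ fun j => ?_
  cases j with
  | zero => exact measurable_const
  | succ j => exact measurable_pi_apply j

theorem letterMeasure_apply (s : Set (Fin (n + 1))) :
    letterMeasure n s = ∑ i, ((n : ℝ≥0∞) + 1)⁻¹ * s.indicator 1 i := by
  unfold letterMeasure
  rw [PMF.toMeasure_apply _ MeasurableSet.of_discrete, tsum_fintype]
  refine Finset.sum_congr rfl fun i _ => ?_
  by_cases h : i ∈ s <;> simp [h]

theorem addressMeasure_eq_sum :
    addressMeasure n =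
      ∑ i, ((n : ℝ≥0∞) + 1)⁻¹ • (addressMeasure n).map (consAddress i) := by
  classical
  symm
  refine Measure.eq_infinitePi _ fun s t ht => ?_
  obtain ⟨N, hN⟩ : ∃ N, s ⊆ Finset.range (N + 1) :=
    ⟨s.sup id, fun j hj => Finset.mem_range_succ_iff.2 (Finset.le_sup (f := id) hj)⟩
  let t' : ℕ → Set (Fin (n + 1)) := fun j => if j ∈ s then t j else univ
  have ht' : ∀ j, MeasurableSet (t' j) := fun j => MeasurableSet.of_discrete
  have h1 : Set.pi (s : Set ℕ) t = Set.pi (Finset.range (N + 1) : Set ℕ) t' := by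
    ext w
    simp only [Set.mem_pi, Finset.mem_coe, t']
    constructor
    · intro h j _
      by_cases hj : j ∈ s
      · simpa [hj] using h j hj
      · simp [hj]
    · intro h j hj
      simpa [hj] using h j (hN hj)
  have h2 : ∏ j ∈ s, letterMeasure n (t j) = ∏ j ∈ Finset.range (N + 1), letterMeasure n (t' j) := by
    rw [← Finset.prod_subset hN]
    · exact Finset.prod_congr rfl fun j hj => by simp [t', hj]
    · intro j _ hj; simp [t', hj]
  rw [h1, h2, Finset.prod_range_succ', letterMeasure_apply, Measure.finsetSum_apply, Finset.mul_sum]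
  refine Finset.sum_congr rfl fun i _ => ?_
  have hm : MeasurableSet (Set.pi (Finset.range (N + 1) : Set ℕ) t') :=
    MeasurableSet.pi (Finset.countable_toSet _) fun j _ => ht' j
  rw [Measure.smul_apply, Measure.map_apply (measurable_consAddress i) hm, smul_eq_mul]
  by_cases hi : i ∈ t' 0
  · have h3 : consAddress i ⁻¹' Set.pi (Finset.range (N + 1) : Set ℕ) t' =
        Set.pi (Finset.range N : Set ℕ) fun j => t' (j + 1) := by
      ext w
      simp only [mem_preimage, Set.mem_pi, Finset.mem_coe, Finset.mem_range]
      constructor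
      · intro h j hj
        exact h (j + 1) (by omega)
      · intro h j hj
        cases j with
        | zero => exact hi
        | succ j => exact h j (by omega)
    rw [h3, addressMeasure, Measure.infinitePi_pi _ (fun j _ => ht' _)]
    simp [hi, mul_comm]
  · have h3 : consAddress i ⁻¹' Set.pi (Finset.range (N + 1) : Set ℕ) t' = ∅ := by
      ext w
      simp only [mem_preimage, Set.mem_pi, Finset.mem_coe, Finset.mem_range, mem_empty_iff_false,
        iff_false]
      exact fun h => hi (h 0 (by omega))
    rw [h3]
    simp [hi]

instance : IsProbabilityMeasure (stdMeasure q) :=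
  Measure.isProbabilityMeasure_map (addressPoint_continuous q).measurable.aemeasurable

/-- The standard measure satisfies the self-similar identity with equal weights. -/
theorem stdMeasure_selfSimilar {X : Set (EuclideanSpace ℝ (Fin n))} (hX : MeasurableSet X) :
    stdMeasure q X = ∑ i, ((n : ℝ≥0∞) + 1)⁻¹ * stdMeasure q (contraction q i ⁻¹' X) := by
  have hp := (addressPoint_continuous q).measurable
  have hc : ∀ i, Measurable (contraction q i) := fun i => by
    have : Continuous (contraction q i) := by unfold contraction; fun_prop
    exact this.measurable
  have h : stdMeasure q X = addressMeasure n (addressPoint q ⁻¹' X) := Measure.map_apply hp hX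
  rw [h, addressMeasure_eq_sum, Measure.finsetSum_apply]
  refine Finset.sum_congr rfl fun i _ => ?_
  rw [Measure.smul_apply, Measure.map_apply (measurable_consAddress i) (hp hX), smul_eq_mul,
    stdMeasure, Measure.map_apply hp (hc i hX), ← preimage_comp, ← preimage_comp]
  congr 3
  funext w
  exact addressPoint_cons q i w

end SierpinskiGasket

end

open SierpinskiGasket

open SierpinskiGasket

/-! The whole theorem rests on one distance formula: a point `F_w(x)` of a cell of level `k` has
intrinsic distance `2^{-k}(1 - [x]_i)` to the boundary point `F_w(q_i)`
(`intrinsicDist_boundaryPoint`). For the upper bound, write `x = ∑ 2^{-j} q_{w_j}` and walk from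
`q_i` along successive edges in the directions `q_{w_j} - q_i`; letters equal to `i` cost nothing,
so the total length is `1 - [x]_i` (`exists_curve_from_vertex`). For the lower bound, a curve in the
gasket is at least as long as the change of any barycentric coordinate along it
(`ofReal_coord_sub_le_hausdorff`). In dimension at least two this fails for curves in the whole
simplex and comes from the self-similar structure.

A geodesic from `F_w(x)` to `F_v(y)` through the common path `σ` of length `L` then consists of
three pieces of lengths `2^{-k}(1 - [x]_i)`, `L` and `2^{-m}(1 - [y]_j)`. Its total length and its
entry and exit times are thereby determined, and between these times its position on `σ` at time `t`
is an affine function of `[x]_i` and `[y]_j` (`IsPiece.apply_eq`). Up to an affine change of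
parameter this function is `ψ_t([x]_i, [y]_j)` (`position_eq`), so `Z_t` does not depend on the
selected geodesics and factors through the unit square.

On cells the standard measure is a scaled copy of itself (`stdMeasure_restrict_cell`), and by
symmetry all coordinates have the law `ν_n` (`stdMeasure_map_coord`). The law of `([x]_i, [y]_j)` is
therefore `ν_n × ν_n`, and pushing it forward gives the formula for `η_t`. -/

namespace SierpinskiGasket

variable {n : ℕ} (q : Vertices n)

/-! ### Barycentric coordinates and cells of level one -/

theorem coord_contraction (i j : Fin (n + 1)) (x : EuclideanSpace ℝ (Fin n)) :
    q.coord j (contraction q i x) = 1 / 2 * (q.coord j x + if j = i then 1 else 0) := by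
  have h : contraction q i x = AffineMap.lineMap x (q i) (1 / 2 : ℝ) := by
    rw [AffineMap.lineMap_apply_module, contraction, smul_add]; norm_num
  rw [h, AffineMap.apply_lineMap, AffineMap.lineMap_apply_module, q.coord_apply]
  simp only [smul_eq_mul]; ring

theorem continuous_contraction (i : Fin (n + 1)) : Continuous (contraction q i) := by
  unfold contraction; fun_prop

theorem continuous_coord (i : Fin (n + 1)) : Continuous (q.coord i) :=
  (q.coord i).continuous_of_finiteDimensional

theorem contraction_vertex_comm (i j : Fin (n + 1)) :
    contraction q i (q j) = contraction q j (q i) := by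
  unfold contraction; rw [add_comm]

theorem contraction_vertex_self (i : Fin (n + 1)) : contraction q i (q i) = q i := by
  unfold contraction; rw [← two_smul ℝ (q i), smul_smul]; norm_num

/-- The inverse of the contraction `F_i`. -/
noncomputable def expansion (i : Fin (n + 1)) (x : EuclideanSpace ℝ (Fin n)) : EuclideanSpace ℝ (Fin n) :=
  (2 : ℝ) • x - q i

theorem expansion_contraction (i : Fin (n + 1)) (x : EuclideanSpace ℝ (Fin n)) :
    expansion q i (contraction q i x) = x := by
  unfold expansion contraction; rw [smul_smul]; norm_num

theorem contraction_injective (i : Fin (n + 1)) : Function.Injective (contraction q i) :=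
  Function.LeftInverse.injective (expansion_contraction q i)

theorem continuous_expansion (i : Fin (n + 1)) : Continuous (expansion q i) := by
  unfold expansion; fun_prop

theorem lipschitzWith_expansion (i : Fin (n + 1)) : LipschitzWith 2 (expansion q i) := by
  refine LipschitzWith.of_dist_le_mul fun x y => ?_
  unfold expansion
  rw [dist_sub_right, dist_smul₀]; simp

theorem hasSum_half_pow : HasSum (fun j : ℕ => (1 / 2 : ℝ) ^ (j + 1)) 1 := by
  have h := hasSum_geometric_two.mul_left (1 / 2 : ℝ)
  norm_num at h
  simpa [pow_succ'] using h

/-- A coordinate is affine, so its constant part `q.coord i 0` is spread over the terms with weights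
`2^{-(j+1)}`, whose sum is one. The `i`-th coordinate thus reads off the binary positions at which
the letter `i` occurs. -/
theorem hasSum_coord_addressPoint (i : Fin (n + 1)) (w : ℕ → Fin (n + 1)) :
    HasSum (fun j : ℕ => (1 / 2 : ℝ) ^ (j + 1) * if i = w j then 1 else 0)
      (q.coord i (addressPoint q w)) := by
  have hs := (summable_address q w).hasSum
  have h1 := (LinearMap.toContinuousLinearMap (q.coord i).linear).hasSum hs
  have h2 := h1.add (hasSum_half_pow.mul_right (q.coord i 0))
  have hd : ∀ y, q.coord i y = (q.coord i).linear y + q.coord i 0 := fun y => by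
    have := (q.coord i).linearMap_vsub y 0
    rw [vsub_eq_sub, vsub_eq_sub, sub_zero] at this
    rw [this]; ring
  rw [hd (addressPoint q w)]
  rw [one_mul] at h2
  have h3 : (fun j : ℕ => (1 / 2 : ℝ) ^ (j + 1) * if i = w j then (1 : ℝ) else 0) =
      fun j => (1 / 2 : ℝ) ^ (j + 1) * (q.coord i).linear (q (w j)) +
        (1 / 2 : ℝ) ^ (j + 1) * q.coord i 0 := by
    funext j
    rw [← q.coord_apply, hd (q (w j)), mul_add]
  rw [h3]
  simp only [LinearMap.coe_toContinuousLinearMap', map_smul, smul_eq_mul] at h2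
  exact h2

theorem coord_nonneg {x : EuclideanSpace ℝ (Fin n)} (hx : x ∈ gasket q) (i : Fin (n + 1)) :
    0 ≤ q.coord i x := by
  obtain ⟨w, rfl⟩ := hx
  refine (hasSum_coord_addressPoint q i w).nonneg fun j => ?_
  split_ifs <;> positivity

theorem coord_le_one {x : EuclideanSpace ℝ (Fin n)} (hx : x ∈ gasket q) (i : Fin (n + 1)) :
    q.coord i x ≤ 1 := by
  rw [← q.sum_coord_apply_eq_one x]
  exact Finset.single_le_sum (fun j _ => coord_nonneg q hx j) (Finset.mem_univ i)

theorem eq_vertex_of_coord_eq_one {x : EuclideanSpace ℝ (Fin n)} (hx : x ∈ gasket q)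
    {i : Fin (n + 1)} (h : q.coord i x = 1) : x = q i := by
  refine q.ext_elem fun j => ?_
  rw [q.coord_apply]
  split_ifs with hj
  · rw [hj, h]
  · have h1 := q.sum_coord_apply_eq_one x
    have h2 : q.coord i x + q.coord j x ≤ ∑ l, q.coord l x := by
      rw [← Finset.sum_pair (f := fun l => q.coord l x) (Ne.symm hj)]
      exact Finset.sum_le_sum_of_subset_of_nonneg (Finset.subset_univ _)
        fun l _ _ => coord_nonneg q hx l
    linarith [coord_nonneg q hx j]

theorem vertex_mem_gasket (i : Fin (n + 1)) : q i ∈ gasket q := by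
  refine ⟨fun _ => i, ?_⟩
  have := hasSum_half_pow.smul_const (q i)
  rw [one_smul] at this
  exact this.tsum_eq

theorem contraction_mem_gasket (i : Fin (n + 1)) {x : EuclideanSpace ℝ (Fin n)}
    (hx : x ∈ gasket q) : contraction q i x ∈ gasket q := by
  rw [gasket_eq_iUnion]; exact mem_iUnion.2 ⟨i, mem_image_of_mem _ hx⟩

theorem isClosed_image_contraction (i : Fin (n + 1)) : IsClosed (contraction q i '' gasket q) :=
  ((gasket_isCompact q).image (continuous_contraction q i)).isClosed

theorem expansion_mem_gasket {i : Fin (n + 1)} {x : EuclideanSpace ℝ (Fin n)}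
    (hx : x ∈ contraction q i '' gasket q) : expansion q i x ∈ gasket q := by
  obtain ⟨y, hy, rfl⟩ := hx
  rwa [expansion_contraction]

theorem coord_expansion {i : Fin (n + 1)} {x : EuclideanSpace ℝ (Fin n)}
    (hx : x ∈ contraction q i '' gasket q) (j : Fin (n + 1)) :
    q.coord j (expansion q i x) = 2 * q.coord j x - if j = i then 1 else 0 := by
  obtain ⟨y, hy, rfl⟩ := hx
  rw [expansion_contraction, coord_contraction]; ring

/-- Different cells of level one meet at most in the midpoint of an edge. -/
theorem inter_image_contraction {i l : Fin (n + 1)} (hil : l ≠ i) :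
    contraction q l '' gasket q ∩ contraction q i '' gasket q ⊆ {contraction q l (q i)} := by
  rintro x ⟨⟨y, hy, rfl⟩, ⟨z, hz, hzx⟩⟩
  have h1 := congrArg (q.coord i) hzx
  rw [coord_contraction, coord_contraction, if_pos rfl, if_neg hil.symm] at h1
  have h2 := coord_nonneg q hz i
  have h3 := coord_le_one q hy i
  rw [eq_vertex_of_coord_eq_one q hy (i := i) (by linarith)]
  rfl

/-- In a cell `F_l(S_n)` with `l ≠ i` the `i`-th coordinate is at most `1/2`, with equality only at
`F_l(q_i) = F_i(q_l)`, which also belongs to the cell of `i`. -/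
theorem mem_image_contraction_of_half_le {x : EuclideanSpace ℝ (Fin n)} (hx : x ∈ gasket q)
    {i : Fin (n + 1)} (h : 1 / 2 ≤ q.coord i x) : x ∈ contraction q i '' gasket q := by
  rw [gasket_eq_iUnion] at hx
  obtain ⟨l, y, hy, rfl⟩ := by simpa only [mem_iUnion, mem_image] using hx
  by_cases hl : i = l
  · rw [hl]; exact mem_image_of_mem _ hy
  · rw [coord_contraction, if_neg hl] at h
    rw [eq_vertex_of_coord_eq_one q hy (i := i) (by linarith [coord_le_one q hy i]),
      contraction_vertex_comm]
    exact mem_image_of_mem _ (vertex_mem_gasket q l)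

/-- The edges of the simplex lie in the gasket. -/
theorem edge_subset_gasket (i j : Fin (n + 1)) {s : ℝ} (hs : s ∈ Icc (0 : ℝ) 1) :
    q i + s • (q j - q i) ∈ gasket q := by
  let e : ℝ → EuclideanSpace ℝ (Fin n) := fun s => q i + s • (q j - q i)
  have he : Continuous e := by fun_prop
  have hS0 := gasket_nonempty q
  obtain ⟨s₀, hs₀, hmax⟩ := (isCompact_Icc (a := (0 : ℝ)) (b := 1)).exists_isMaxOn
    ⟨0, by simp⟩ ((Metric.continuous_infDist_pt (gasket q)).comp he).continuousOn
  -- The edge point farthest from the gasket is the image of another edge point under some `F_l`,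
  -- which halves distances and maps the gasket into itself. So the maximal distance is at most half
  -- of itself.
  have key : ∀ l, ∀ r ∈ Icc (0 : ℝ) 1, e s₀ = contraction q l (e r) →
      Metric.infDist (e s₀) (gasket q) ≤ 0 := by
    intro l r hr hl
    obtain ⟨z, hz, hyz⟩ := (gasket_isCompact q).exists_infDist_eq_dist hS0 (e r)
    have h1 := Metric.infDist_le_dist_of_mem (x := e s₀) (contraction_mem_gasket q l hz)
    rw [hl, dist_contraction, ← hyz, ← hl] at h1
    have h2 : Metric.infDist (e r) (gasket q) ≤ Metric.infDist (e s₀) (gasket q) := hmax hr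
    linarith
  have h0 : Metric.infDist (e s₀) (gasket q) ≤ 0 := by
    rcases le_total s₀ (1 / 2) with h | h
    · refine key i (2 * s₀) ⟨by linarith [hs₀.1], by linarith⟩ ?_
      simp only [e, contraction]; module
    · refine key j (2 * s₀ - 1) ⟨by linarith, by linarith [hs₀.2]⟩ ?_
      simp only [e, contraction]; module
  have h4 : Metric.infDist (e s) (gasket q) ≤ Metric.infDist (e s₀) (gasket q) := hmax hs
  exact ((gasket_isCompact q).isClosed.mem_iff_infDist_zero hS0).2
    (le_antisymm (h4.trans h0) Metric.infDist_nonneg)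

/-! ### One-dimensional Hausdorff measure of curves -/

theorem hausdorff_image_le {α β : Type*} [MeasurableSpace α] [EMetricSpace α] [BorelSpace α]
    [MeasurableSpace β] [EMetricSpace β] [BorelSpace β] {f : α → β} {s : Set α} {K : NNReal}
    (h : LipschitzOnWith K f s) : Measure.hausdorffMeasure 1 (f '' s) ≤
      K * Measure.hausdorffMeasure 1 s := by
  simpa using h.hausdorffMeasure_image_le (zero_le_one (α := ℝ))

theorem hausdorff_Icc (a b : ℝ) :
    Measure.hausdorffMeasure 1 (Icc a b) = ENNReal.ofReal (b - a) := by
  rw [hausdorffMeasure_real, Real.volume_Icc]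

/-- The distance from `γ s` is a 1-Lipschitz function, and it maps the connected image of `γ` onto a
set containing `[0, dist (γ s) (γ t)]`. -/
theorem dist_le_hausdorff {X : Type*} [MetricSpace X] [MeasurableSpace X] [BorelSpace X]
    {γ : ℝ → X} {a b s t : ℝ} (hγ : ContinuousOn γ (Icc a b)) (hs : s ∈ Icc a b)
    (ht : t ∈ Icc a b) :
    ENNReal.ofReal (dist (γ s) (γ t)) ≤ Measure.hausdorffMeasure 1 (γ '' Icc a b) := by
  have hc : IsPreconnected ((fun y => dist (γ s) y) '' (γ '' Icc a b)) :=
    (isPreconnected_Icc.image _ hγ).image _ (by fun_prop)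
  have hsub : Icc 0 (dist (γ s) (γ t)) ⊆ (fun y => dist (γ s) y) '' (γ '' Icc a b) :=
    hc.Icc_subset ⟨γ s, mem_image_of_mem _ hs, dist_self _⟩ ⟨γ t, mem_image_of_mem _ ht, rfl⟩
  have h1 := measure_mono (μ := Measure.hausdorffMeasure 1) hsub
  rw [hausdorff_Icc, sub_zero] at h1
  refine h1.trans ?_
  simpa using hausdorff_image_le (LipschitzWith.dist_right (γ s)).lipschitzOnWith
    (s := γ '' Icc a b)

/-- Single points are null for one-dimensional Hausdorff measure. Lengths are measures of images, so
pieces of a curve add up only when their images hardly meet. -/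
theorem hausdorff_add_le {X : Type*} [MetricSpace X] [MeasurableSpace X] [BorelSpace X]
    {C D E : Set X} {p : X} (hD : IsCompact D) (hCE : C ⊆ E) (hDE : D ⊆ E)
    (hp : C ∩ D ⊆ {p}) :
    Measure.hausdorffMeasure 1 C + Measure.hausdorffMeasure 1 D ≤
      Measure.hausdorffMeasure 1 E := by
  have : NullSingletonClass (Measure.hausdorffMeasure 1 : Measure X) :=
    Measure.nullSingletonClass_hausdorff X one_pos
  rw [← measure_union_add_inter C hD.isClosed.measurableSet,
    measure_mono_null hp (measure_singleton p), add_zero]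
  exact measure_mono (union_subset hCE hDE)

theorem hausdorff_expansion_image_le (i : Fin (n + 1)) (γ : ℝ → EuclideanSpace ℝ (Fin n))
    (T : Set ℝ) : Measure.hausdorffMeasure 1 ((expansion q i ∘ γ) '' T) ≤
      2 * Measure.hausdorffMeasure 1 (γ '' T) := by
  rw [image_comp]
  exact hausdorff_image_le (lipschitzWith_expansion q i).lipschitzOnWith

/-! ### Crossings -/

/-- A continuous function that passes from below `c` to above `c'` crosses `(c, c')`. -/
theorem exists_crossing {g : ℝ → ℝ} {a b c c' : ℝ} (hab : a ≤ b) (hg : ContinuousOn g (Icc a b))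
    (hc : c < c') (ha : g a ≤ c) (hb : c' ≤ g b) :
    ∃ s t, a ≤ s ∧ s < t ∧ t ≤ b ∧ g s = c ∧ g t = c' ∧ ∀ u ∈ Ioo s t, g u ∈ Ioo c c' := by
  have hT : IsCompact (Icc a b ∩ g ⁻¹' Ici c') :=
    isCompact_Icc.of_isClosed_subset (hg.preimage_isClosed_of_isClosed isClosed_Icc isClosed_Ici)
      inter_subset_left
  -- `t` is the first time at which `g` reaches `c'`, and `s` below is the last time before `t` at
  -- which `g` is at most `c`.
  obtain ⟨t, ⟨ht, htc⟩, htmin⟩ := hT.exists_isLeast ⟨b, right_mem_Icc.2 hab, hb⟩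
  have hg' : ContinuousOn g (Icc a t) := hg.mono (Icc_subset_Icc_right ht.2)
  have hS : IsCompact (Icc a t ∩ g ⁻¹' Iic c) :=
    isCompact_Icc.of_isClosed_subset (hg'.preimage_isClosed_of_isClosed isClosed_Icc isClosed_Iic)
      inter_subset_left
  obtain ⟨s, ⟨hs, hsc⟩, hsmax⟩ := hS.exists_isGreatest ⟨a, left_mem_Icc.2 ht.1, ha⟩
  simp only [mem_preimage, mem_Ici, mem_Iic] at htc hsc
  have hst : s < t := lt_of_le_of_ne hs.2 (by rintro rfl; linarith)
  have hin : ∀ u ∈ Ioo s t, g u ∈ Ioo c c' := by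
    intro u hu
    constructor
    · by_contra! h
      exact absurd (hsmax ⟨⟨hs.1.trans hu.1.le, hu.2.le⟩, h⟩) (not_le.2 hu.1)
    · by_contra! h
      exact absurd (htmin ⟨⟨hs.1.trans hu.1.le, hu.2.le.trans ht.2⟩, h⟩) (not_le.2 hu.2)
  have hcl : g '' Icc s t ⊆ Icc c c' := by
    have h1 := ContinuousOn.image_closure (f := g) (s := Ioo s t)
      (by rw [closure_Ioo hst.ne]; exact hg'.mono (Icc_subset_Icc_left hs.1))
    rw [closure_Ioo hst.ne] at h1
    refine h1.trans (closure_minimal ?_ isClosed_Icc)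
    rintro _ ⟨u, hu, rfl⟩
    exact Ioo_subset_Icc_self (hin u hu)
  refine ⟨s, t, hs.1, hst, ht.2, le_antisymm hsc ?_, le_antisymm ?_ htc, hin⟩
  · exact (hcl (mem_image_of_mem _ (left_mem_Icc.2 hst.le))).1
  · exact (hcl (mem_image_of_mem _ (right_mem_Icc.2 hst.le))).2

theorem mapsTo_Icc_of_mapsTo_Ioo {X : Type*} [TopologicalSpace X] {γ : ℝ → X} {s t : ℝ}
    (hst : s < t) {T : Set X} (hT : IsClosed T) (hγ : ContinuousOn γ (Icc s t))
    (h : MapsTo γ (Ioo s t) T) : MapsTo γ (Icc s t) T := by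
  have h1 := ContinuousOn.image_closure (f := γ) (s := Ioo s t) (by rwa [closure_Ioo hst.ne])
  rw [closure_Ioo hst.ne] at h1
  exact mapsTo_iff_image_subset.2 (h1.trans (closure_minimal h.image_subset hT))

/-- A curve in the gasket whose `i`-th coordinate stays strictly between `0` and `1/2` stays in one
cell of level one. -/
theorem mapsTo_one_cell {γ : ℝ → EuclideanSpace ℝ (Fin n)} {s t : ℝ} (hst : s < t)
    (hγ : ContinuousOn γ (Icc s t)) (hS : MapsTo γ (Icc s t) (gasket q)) {i : Fin (n + 1)}
    (hi : ∀ u ∈ Ioo s t, q.coord i (γ u) ∈ Ioo 0 (1 / 2)) :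
    ∃ l, l ≠ i ∧ MapsTo γ (Icc s t) (contraction q l '' gasket q) := by
  have hmid : (s + t) / 2 ∈ Ioo s t := ⟨by linarith, by linarith⟩
  have hm := hS (Ioo_subset_Icc_self hmid)
  rw [gasket_eq_iUnion] at hm
  obtain ⟨l, hl⟩ := mem_iUnion.1 hm
  have hli : l ≠ i := by
    rintro rfl
    obtain ⟨y, hy, hyx⟩ := hl
    have h1 := (hi _ hmid).2
    rw [← hyx, coord_contraction, if_pos rfl] at h1
    linarith [coord_nonneg q hy l]
  refine ⟨l, hli, mapsTo_Icc_of_mapsTo_Ioo hst (isClosed_image_contraction q l) hγ ?_⟩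
  have hpre : IsPreconnected (γ '' Ioo s t) :=
    isPreconnected_Ioo.image _ (hγ.mono Ioo_subset_Icc_self)
  have hcov : γ '' Ioo s t ⊆ contraction q l '' gasket q ∪
      ⋃ l' : {l' // l' ≠ l}, contraction q l' '' gasket q := by
    rintro _ ⟨u, hu, rfl⟩
    have h1 := hS (Ioo_subset_Icc_self hu)
    rw [gasket_eq_iUnion] at h1
    obtain ⟨l', hl'⟩ := mem_iUnion.1 h1
    by_cases h : l' = l
    · left; rwa [← h]
    · right; exact mem_iUnion.2 ⟨⟨l', h⟩, hl'⟩
  -- Since `l ≠ i`, the common point of the cells of `l` and `l'` has `i`-th coordinate `0` or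
  -- `1/2`. Along the open piece these closed cells are therefore disjoint, and connectedness
  -- selects one of them.
  have hdis : ∀ u ∈ Ioo s t, ∀ l', l' ≠ l → γ u ∈ contraction q l '' gasket q →
      γ u ∉ contraction q l' '' gasket q := by
    intro u hu l' hne h1 h2
    have h2 := inter_image_contraction q hne ⟨h2, h1⟩
    have h3 := hi u hu
    rw [mem_singleton_iff.1 h2, coord_contraction, q.coord_apply, if_neg hli.symm] at h3
    split_ifs at h3 <;> norm_num at h3
  have hemp : γ '' Ioo s t ∩ (contraction q l '' gasket q ∩
      ⋃ l' : {l' // l' ≠ l}, contraction q l' '' gasket q) = ∅ := by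
    rw [eq_empty_iff_forall_notMem]
    rintro _ ⟨⟨u, hu, rfl⟩, h1, h2⟩
    obtain ⟨l', hl'⟩ := mem_iUnion.1 h2
    exact hdis u hu l' l'.2 h1 hl'
  rcases isPreconnected_iff_subset_of_disjoint_closed.1 hpre _ _ (isClosed_image_contraction q l)
    (isClosed_iUnion_of_finite fun l' : {l' // l' ≠ l} => isClosed_image_contraction q l')
    hcov hemp with h | h
  · exact mapsTo_iff_image_subset.2 h
  · obtain ⟨l', hl'⟩ := mem_iUnion.1 (h (mem_image_of_mem _ hmid))
    exact absurd hl' (hdis _ hmid l' l'.2 hl)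

theorem continuousOn_expansion_comp {γ : ℝ → EuclideanSpace ℝ (Fin n)} {s t : ℝ}
    (hγ : ContinuousOn γ (Icc s t)) (l : Fin (n + 1)) :
    ContinuousOn (expansion q l ∘ γ) (Icc s t) :=
  (continuous_expansion q l).comp_continuousOn hγ

theorem ofReal_half_le {x : ℝ} {y : ℝ≥0∞} (h : ENNReal.ofReal (2 * x) ≤ 2 * y) :
    ENNReal.ofReal x ≤ y := by
  rw [ENNReal.ofReal_mul (by norm_num), ENNReal.ofReal_ofNat] at h
  exact (ENNReal.mul_le_mul_iff_right (by norm_num) (by norm_num)).1 h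

/-- A curve in the gasket that ends in `q i` and starts outside `F_i(S_n)` runs inside `F_i(S_n)`,
from some time on, from another vertex of this cell. -/
theorem exists_final_piece {γ : ℝ → EuclideanSpace ℝ (Fin n)} {a b : ℝ} (hab : a ≤ b)
    (hγ : ContinuousOn γ (Icc a b)) (hS : MapsTo γ (Icc a b) (gasket q)) {i : Fin (n + 1)}
    (hb : γ b = q i) (ha : q.coord i (γ a) < 1 / 2) :
    ∃ s ∈ Icc a b, ∃ l, l ≠ i ∧ γ s = contraction q l (q i) ∧
      MapsTo γ (Icc s b) (contraction q i '' gasket q) := by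
  have hcover : ∀ u ∈ Icc a b, γ u ∈ (⋃ l : {l // l ≠ i}, contraction q l '' gasket q) ∨
      γ u ∈ contraction q i '' gasket q := by
    intro u hu
    have h1 := hS hu
    rw [gasket_eq_iUnion] at h1
    obtain ⟨l, hl⟩ := mem_iUnion.1 h1
    by_cases h : l = i
    · right; rwa [← h]
    · left; exact mem_iUnion.2 ⟨⟨l, h⟩, hl⟩
  have hhalf : ∀ x ∈ contraction q i '' gasket q, 1 / 2 ≤ q.coord i x := by
    rintro _ ⟨y, hy, rfl⟩
    rw [coord_contraction, if_pos rfl]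
    linarith [coord_nonneg q hy i]
  have hcl : IsClosed (⋃ l : {l // l ≠ i}, contraction q l '' gasket q) :=
    isClosed_iUnion_of_finite fun l : {l // l ≠ i} => isClosed_image_contraction q l
  have hK : IsCompact (Icc a b ∩ γ ⁻¹' ⋃ l : {l // l ≠ i}, contraction q l '' gasket q) :=
    isCompact_Icc.of_isClosed_subset (hγ.preimage_isClosed_of_isClosed isClosed_Icc hcl)
      inter_subset_left
  -- `s` is the last visit to a cell other than that of `i`; afterwards only the cell of `i`
  -- remains.
  obtain ⟨s, ⟨hs, hsl⟩, hmax⟩ := hK.exists_isGreatest ⟨a, left_mem_Icc.2 hab,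
    (hcover a (left_mem_Icc.2 hab)).resolve_right fun h => by linarith [hhalf _ h]⟩
  obtain ⟨⟨l, hl⟩, hsl⟩ := mem_iUnion.1 hsl
  have hsb : s < b := by
    refine lt_of_le_of_ne hs.2 ?_
    rintro rfl
    obtain ⟨y, hy, hyb⟩ := hsl
    have h1 := congrArg (q.coord i) hyb
    rw [coord_contraction, if_neg (Ne.symm hl), hb, q.coord_apply, if_pos rfl] at h1
    linarith [coord_le_one q hy i]
  have hmaps : MapsTo γ (Icc s b) (contraction q i '' gasket q) := by
    refine mapsTo_Icc_of_mapsTo_Ioo hsb (isClosed_image_contraction q i)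
      (hγ.mono (Icc_subset_Icc_left hs.1)) fun u hu => ?_
    have hu' : u ∈ Icc a b := ⟨hs.1.trans hu.1.le, hu.2.le⟩
    exact (hcover u hu').resolve_left fun h => absurd (hmax ⟨hu', h⟩) (not_le.2 hu.1)
  exact ⟨s, hs, l, hl, inter_image_contraction q hl ⟨hsl, hmaps (left_mem_Icc.2 hsb.le)⟩, hmaps⟩

/-- A crossing of the coordinate range `(c, 1/2)` contains a curve in one cell of level one. -/
theorem exists_lower_crossing {γ : ℝ → EuclideanSpace ℝ (Fin n)} {a b c' : ℝ} (hab : a ≤ b)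
    (hγ : ContinuousOn γ (Icc a b)) (hS : MapsTo γ (Icc a b) (gasket q)) {i : Fin (n + 1)}
    (hac : q.coord i (γ a) < c') (hc : c' ≤ 1 / 2) (hcb : c' ≤ q.coord i (γ b)) :
    ∃ s t l, a ≤ s ∧ s < t ∧ t ≤ b ∧ l ≠ i ∧ MapsTo γ (Icc s t) (contraction q l '' gasket q) ∧
      q.coord i (expansion q l (γ s)) = 2 * q.coord i (γ a) ∧
      q.coord i (expansion q l (γ t)) = 2 * c' := by
  obtain ⟨s, t, h1, h2, h3, h4, h5, h6⟩ := exists_crossing hab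
    ((continuous_coord q i).comp_continuousOn hγ) hac le_rfl hcb
  have hsub : Icc s t ⊆ Icc a b := Icc_subset_Icc h1 h3
  obtain ⟨l, hl, hm⟩ := mapsTo_one_cell q h2 (hγ.mono hsub) (hS.mono_left hsub) (i := i)
    fun u hu => ⟨(coord_nonneg q (hS (left_mem_Icc.2 hab)) i).trans_lt (h6 u hu).1,
      (h6 u hu).2.trans_le hc⟩
  refine ⟨s, t, l, h1, h2, h3, hl, hm, ?_, ?_⟩
  · rw [coord_expansion q (hm (left_mem_Icc.2 h2.le)), if_neg hl.symm, sub_zero]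
    exact congrArg (2 * ·) h4
  · rw [coord_expansion q (hm (right_mem_Icc.2 h2.le)), if_neg hl.symm, sub_zero]
    exact congrArg (2 * ·) h5

/-- A crossing of the coordinate range `(c, c')` with `1/2 ≤ c` contains a curve in `F_i(S_n)`. -/
theorem exists_upper_crossing {γ : ℝ → EuclideanSpace ℝ (Fin n)} {a b c c' : ℝ} (hab : a ≤ b)
    (hγ : ContinuousOn γ (Icc a b)) (hS : MapsTo γ (Icc a b) (gasket q)) {i : Fin (n + 1)}
    (hac : q.coord i (γ a) ≤ c) (hc : 1 / 2 ≤ c) (hcc : c < c') (hcb : c' ≤ q.coord i (γ b)) :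
    ∃ s t, a ≤ s ∧ s < t ∧ t ≤ b ∧ MapsTo γ (Icc s t) (contraction q i '' gasket q) ∧
      q.coord i (expansion q i (γ s)) = 2 * c - 1 ∧
      q.coord i (expansion q i (γ t)) = 2 * c' - 1 := by
  obtain ⟨s, t, h1, h2, h3, h4, h5, h6⟩ := exists_crossing hab
    ((continuous_coord q i).comp_continuousOn hγ) hcc hac hcb
  have hsub : Icc s t ⊆ Icc a b := Icc_subset_Icc h1 h3
  have hm : MapsTo γ (Icc s t) (contraction q i '' gasket q) :=
    mapsTo_Icc_of_mapsTo_Ioo h2 (isClosed_image_contraction q i) (hγ.mono hsub) fun u hu =>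
      mem_image_contraction_of_half_le q (hS (hsub (Ioo_subset_Icc_self hu)))
        (hc.trans (h6 u hu).1.le)
  refine ⟨s, t, h1, h2, h3, hm, ?_, ?_⟩
  · rw [coord_expansion q (hm (left_mem_Icc.2 h2.le)), if_pos rfl]
    exact congrArg (2 * · - 1) h4
  · rw [coord_expansion q (hm (right_mem_Icc.2 h2.le)), if_pos rfl]
    exact congrArg (2 * · - 1) h5

/-! ### The length of a curve bounds the change of a coordinate -/

variable {q}

/-- Induction on the scale: expanding a piece inside a cell of level one doubles the change of the
coordinate and at most doubles the length, so the error `(1/2)^N` is halved. Two pieces with an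
error each would lose this gain. Ending at `q i` avoids this, because the last piece, which runs
from a vertex of the cell of `i` to `q i`, has length at least `1/2` without error by the Euclidean
distance. -/
theorem le_hausdorff_to_vertex_aux (hq : UnitSides q) (i : Fin (n + 1)) (N : ℕ) :
    ∀ (γ : ℝ → EuclideanSpace ℝ (Fin n)) (a b : ℝ), a ≤ b → ContinuousOn γ (Icc a b) →
      MapsTo γ (Icc a b) (gasket q) → γ b = q i →
      ENNReal.ofReal (1 - q.coord i (γ a) - (1 / 2) ^ N) ≤
        Measure.hausdorffMeasure 1 (γ '' Icc a b) := by
  induction N with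
  | zero =>
    intro γ a b hab hγ hS hb
    rw [ENNReal.ofReal_of_nonpos]
    · exact zero_le
    · have := coord_nonneg q (hS (left_mem_Icc.2 hab)) i
      rw [pow_zero]; linarith
  | succ N ih =>
    intro γ a b hab hγ hS hb
    have hfb : q.coord i (γ b) = 1 := by rw [hb, q.coord_apply, if_pos rfl]
    rcases (coord_le_one q (hS (left_mem_Icc.2 hab)) i).eq_or_lt with h1 | h1
    · rw [ENNReal.ofReal_of_nonpos]
      · exact zero_le
      · rw [h1]; have : (0 : ℝ) < (1 / 2) ^ (N + 1) := by positivity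
        linarith
    rcases le_or_gt (1 / 2) (q.coord i (γ a)) with hc | hc
    · obtain ⟨s, t, has, hst, htb, hm, hs, ht⟩ :=
        exists_upper_crossing q hab hγ hS le_rfl hc h1 hfb.ge
      have hsub : Icc s t ⊆ Icc a b := Icc_subset_Icc has htb
      have hm' : MapsTo (expansion q i ∘ γ) (Icc s t) (gasket q) :=
        fun u hu => expansion_mem_gasket q (hm hu)
      have h2 := (ih (expansion q i ∘ γ) s t hst.le
        (continuousOn_expansion_comp q (hγ.mono hsub) i) hm'
        (eq_vertex_of_coord_eq_one q (hm' (right_mem_Icc.2 hst.le))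
          (by rw [Function.comp, ht]; norm_num))).trans (hausdorff_expansion_image_le q i γ _)
      refine (ofReal_half_le ?_).trans (measure_mono (image_mono hsub))
      refine le_of_eq_of_le (congrArg ENNReal.ofReal ?_) h2
      rw [Function.comp_apply, hs, pow_succ]; ring
    · obtain ⟨s, t, l, has, hst, htb, hl, hm, hs, ht⟩ :=
        exists_lower_crossing q hab hγ hS hc le_rfl (by rw [hfb]; norm_num)
      have hsub : Icc s t ⊆ Icc a b := Icc_subset_Icc has htb
      have hm' : MapsTo (expansion q l ∘ γ) (Icc s t) (gasket q) :=
        fun u hu => expansion_mem_gasket q (hm hu)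
      have h2 := (ih (expansion q l ∘ γ) s t hst.le
        (continuousOn_expansion_comp q (hγ.mono hsub) l) hm'
        (eq_vertex_of_coord_eq_one q (hm' (right_mem_Icc.2 hst.le))
          (by rw [Function.comp, ht]; norm_num))).trans (hausdorff_expansion_image_le q l γ _)
      have h3 : ENNReal.ofReal (1 / 2 - q.coord i (γ a) - (1 / 2) ^ (N + 1)) ≤
          Measure.hausdorffMeasure 1 (γ '' Icc s t) := by
        refine ofReal_half_le ?_
        refine le_of_eq_of_le (congrArg ENNReal.ofReal ?_) h2
        rw [Function.comp, hs, pow_succ]; ring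
      obtain ⟨s', hs', l', hl', hsl', hm''⟩ := exists_final_piece q hab hγ hS hb hc
      have hsub' : Icc s' b ⊆ Icc a b := Icc_subset_Icc_left hs'.1
      have h4 : ENNReal.ofReal (1 / 2) ≤ Measure.hausdorffMeasure 1 (γ '' Icc s' b) := by
        have h5 := dist_le_hausdorff (hγ.mono hsub') (left_mem_Icc.2 hs'.2)
          (right_mem_Icc.2 hs'.2)
        rwa [hsl', hb, contraction_vertex_comm, ← contraction_vertex_self q i, dist_contraction,
          hq _ _ hl', mul_one] at h5
      have h6 := hausdorff_add_le (isCompact_Icc.image_of_continuousOn (hγ.mono hsub'))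
        (image_mono (f := γ) hsub) (image_mono hsub')
        ((inter_subset_inter hm.image_subset hm''.image_subset).trans
          (inter_image_contraction q hl))
      refine le_trans ?_ ((add_le_add h3 h4).trans h6)
      refine le_trans (ENNReal.ofReal_le_ofReal ?_) ENNReal.ofReal_add_le
      linarith

theorem ofReal_le_of_forall_sub_pow {x : ℝ} {y : ℝ≥0∞}
    (h : ∀ N : ℕ, ENNReal.ofReal (x - (1 / 2) ^ N) ≤ y) : ENNReal.ofReal x ≤ y := by
  have h1 : Filter.Tendsto (fun N : ℕ => ENNReal.ofReal (x - (1 / 2) ^ N)) Filter.atTop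
      (nhds (ENNReal.ofReal (x - 0))) :=
    (ENNReal.continuous_ofReal.tendsto _).comp
      (tendsto_const_nhds.sub (tendsto_pow_atTop_nhds_zero_of_lt_one (by norm_num) (by norm_num)))
  rw [sub_zero] at h1
  exact le_of_tendsto' h1 h

theorem le_hausdorff_to_vertex (hq : UnitSides q) (i : Fin (n + 1))
    {γ : ℝ → EuclideanSpace ℝ (Fin n)} {a b : ℝ} (hab : a ≤ b) (hγ : ContinuousOn γ (Icc a b))
    (hS : MapsTo γ (Icc a b) (gasket q)) (hb : γ b = q i) :
    ENNReal.ofReal (1 - q.coord i (γ a)) ≤ Measure.hausdorffMeasure 1 (γ '' Icc a b) :=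
  ofReal_le_of_forall_sub_pow fun N => le_hausdorff_to_vertex_aux hq i N γ a b hab hγ hS hb

/-- A curve crossing the level `1/2` is split there. The part below ends, after expansion, at
coordinate one and hence at the vertex `q i`, so `le_hausdorff_to_vertex` bounds it without error.
Only the part above uses the induction hypothesis, and again only one error term occurs. -/
theorem le_hausdorff_aux (hq : UnitSides q) (i : Fin (n + 1)) (N : ℕ) :
    ∀ (γ : ℝ → EuclideanSpace ℝ (Fin n)) (a b : ℝ), a ≤ b → ContinuousOn γ (Icc a b) →
      MapsTo γ (Icc a b) (gasket q) →
      ENNReal.ofReal (q.coord i (γ b) - q.coord i (γ a) - (1 / 2) ^ N) ≤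
        Measure.hausdorffMeasure 1 (γ '' Icc a b) := by
  induction N with
  | zero =>
    intro γ a b hab hγ hS
    rw [ENNReal.ofReal_of_nonpos]
    · exact zero_le
    · have := coord_nonneg q (hS (left_mem_Icc.2 hab)) i
      have := coord_le_one q (hS (right_mem_Icc.2 hab)) i
      rw [pow_zero]; linarith
  | succ N ih =>
    intro γ a b hab hγ hS
    have scaled : ∀ s t l, s < t → Icc s t ⊆ Icc a b →
        MapsTo γ (Icc s t) (contraction q l '' gasket q) → ∀ c,
        q.coord i (expansion q l (γ t)) - q.coord i (expansion q l (γ s)) = 2 * c →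
        ENNReal.ofReal (c - (1 / 2) ^ (N + 1)) ≤
          Measure.hausdorffMeasure 1 (γ '' Icc s t) := by
      intro s t l hst hsub hm c hc
      have h2 := (ih (expansion q l ∘ γ) s t hst.le
        (continuousOn_expansion_comp q (hγ.mono hsub) l)
        (fun u hu => expansion_mem_gasket q (hm hu))).trans (hausdorff_expansion_image_le q l γ _)
      refine ofReal_half_le ?_
      refine le_of_eq_of_le (congrArg ENNReal.ofReal ?_) h2
      simp only [Function.comp, hc, pow_succ]; ring
    rcases le_or_gt (q.coord i (γ b)) (q.coord i (γ a)) with h1 | h1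
    · rw [ENNReal.ofReal_of_nonpos]
      · exact zero_le
      · have : (0 : ℝ) < (1 / 2) ^ (N + 1) := by positivity
        linarith
    rcases le_or_gt (1 / 2) (q.coord i (γ a)) with hc | hc
    · obtain ⟨s, t, has, hst, htb, hm, hs, ht⟩ :=
        exists_upper_crossing q hab hγ hS le_rfl hc h1 le_rfl
      have hsub : Icc s t ⊆ Icc a b := Icc_subset_Icc has htb
      exact (scaled s t i hst hsub hm _ (by rw [hs, ht]; ring)).trans
        (measure_mono (image_mono hsub))
    rcases le_or_gt (q.coord i (γ b)) (1 / 2) with hc' | hc'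
    · obtain ⟨s, t, l, has, hst, htb, hl, hm, hs, ht⟩ :=
        exists_lower_crossing q hab hγ hS h1 hc' le_rfl
      have hsub : Icc s t ⊆ Icc a b := Icc_subset_Icc has htb
      exact (scaled s t l hst hsub hm _ (by rw [hs, ht]; ring)).trans
        (measure_mono (image_mono hsub))
    · obtain ⟨s, t, l, has, hst, htb, hl, hm, hs, ht⟩ :=
        exists_lower_crossing q hab hγ hS hc le_rfl hc'.le
      have hsub : Icc s t ⊆ Icc a b := Icc_subset_Icc has htb
      have hm' : MapsTo (expansion q l ∘ γ) (Icc s t) (gasket q) :=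
        fun u hu => expansion_mem_gasket q (hm hu)
      have h3 : ENNReal.ofReal (1 / 2 - q.coord i (γ a)) ≤
          Measure.hausdorffMeasure 1 (γ '' Icc s t) := by
        refine ofReal_half_le (le_trans (le_of_eq ?_)
          ((le_hausdorff_to_vertex hq i hst.le (continuousOn_expansion_comp q (hγ.mono hsub) l) hm'
            (eq_vertex_of_coord_eq_one q (hm' (right_mem_Icc.2 hst.le))
            (by rw [Function.comp, ht]; norm_num))).trans (hausdorff_expansion_image_le q l γ _)))
        rw [Function.comp, hs]; ring_nf
      obtain ⟨s', t', has', hst', htb', hm'', hs', ht'⟩ :=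
        exists_upper_crossing q hab hγ hS hc.le le_rfl hc' le_rfl
      have hsub' : Icc s' t' ⊆ Icc a b := Icc_subset_Icc has' htb'
      have h4 := scaled s' t' i hst' hsub' hm'' (q.coord i (γ b) - 1 / 2)
        (by rw [hs', ht']; ring)
      have h6 := hausdorff_add_le (isCompact_Icc.image_of_continuousOn (hγ.mono hsub'))
        (image_mono (f := γ) hsub) (image_mono hsub')
        ((inter_subset_inter hm.image_subset hm''.image_subset).trans
          (inter_image_contraction q hl))
      refine le_trans ?_ ((add_le_add h3 h4).trans h6)
      refine le_trans (ENNReal.ofReal_le_ofReal ?_) ENNReal.ofReal_add_le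
      linarith

/-- Barycentric coordinates are `1`-Lipschitz with respect to the length of curves in the gasket. -/
theorem ofReal_coord_sub_le_hausdorff (hq : UnitSides q) (i : Fin (n + 1))
    {γ : ℝ → EuclideanSpace ℝ (Fin n)} {a b : ℝ} (hab : a ≤ b) (hγ : ContinuousOn γ (Icc a b))
    (hS : MapsTo γ (Icc a b) (gasket q)) :
    ENNReal.ofReal (q.coord i (γ b) - q.coord i (γ a)) ≤
      Measure.hausdorffMeasure 1 (γ '' Icc a b) :=
  ofReal_le_of_forall_sub_pow fun N => le_hausdorff_aux hq i N γ a b hab hγ hS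

variable (q)

/-! ### Curves from a vertex to an arbitrary point -/

/-- The length of the `j`-th edge on the way from `q i` to the point with address `w`. -/
noncomputable def edgeLength (i : Fin (n + 1)) (w : ℕ → Fin (n + 1)) (j : ℕ) : ℝ :=
  if i = w j then 0 else (1 / 2) ^ (j + 1)

/-- The length of the first `N` edges on the way from `q i` to the point with address `w`. -/
noncomputable def polygonLength (i : Fin (n + 1)) (w : ℕ → Fin (n + 1)) (N : ℕ) : ℝ :=
  ∑ j ∈ Finset.range N, edgeLength i w j

/-- The part of the `j`-th edge that has been traversed at time `c`. -/
noncomputable def traversed (i : Fin (n + 1)) (w : ℕ → Fin (n + 1)) (j : ℕ) (c : ℝ) : ℝ :=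
  min c (polygonLength i w (j + 1)) - min c (polygonLength i w j)

/-- The polygon along the first `N` edges, parametrized by arc length. -/
noncomputable def polygon (i : Fin (n + 1)) (w : ℕ → Fin (n + 1)) (N : ℕ) (c : ℝ) :
    EuclideanSpace ℝ (Fin n) :=
  q i + ∑ j ∈ Finset.range N, traversed i w j c • (q (w j) - q i)

theorem edgeLength_nonneg (i : Fin (n + 1)) (w : ℕ → Fin (n + 1)) (j : ℕ) :
    0 ≤ edgeLength i w j := by
  unfold edgeLength; split_ifs <;> positivity

theorem edgeLength_le (i : Fin (n + 1)) (w : ℕ → Fin (n + 1)) (j : ℕ) :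
    edgeLength i w j ≤ (1 / 2) ^ (j + 1) := by
  unfold edgeLength; split_ifs <;> [positivity; exact le_rfl]

theorem polygonLength_succ (i : Fin (n + 1)) (w : ℕ → Fin (n + 1)) (N : ℕ) :
    polygonLength i w (N + 1) = polygonLength i w N + edgeLength i w N :=
  Finset.sum_range_succ _ _

theorem polygonLength_mono (i : Fin (n + 1)) (w : ℕ → Fin (n + 1)) :
    Monotone (polygonLength i w) :=
  monotone_nat_of_le_succ fun N => by
    rw [polygonLength_succ]; linarith [edgeLength_nonneg i w N]

theorem polygonLength_cons (i : Fin (n + 1)) (w : ℕ → Fin (n + 1)) (N : ℕ) :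
    polygonLength i w (N + 1) =
      edgeLength i w 0 + 1 / 2 * polygonLength i (fun j => w (j + 1)) N := by
  unfold polygonLength
  rw [Finset.sum_range_succ', add_comm, Finset.mul_sum]
  congr 1
  refine Finset.sum_congr rfl fun j _ => ?_
  unfold edgeLength
  split_ifs
  · simp
  · rw [pow_succ']

theorem traversed_mono (i : Fin (n + 1)) (w : ℕ → Fin (n + 1)) (j : ℕ) :
    Monotone (traversed i w j) := by
  intro c c' h
  have h1 := polygonLength_mono i w (Nat.le_succ j)
  unfold traversed
  rcases le_total c (polygonLength i w j) with h2 | h2 <;>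
  rcases le_total c' (polygonLength i w j) with h3 | h3 <;>
  rcases le_total c (polygonLength i w (j + 1)) with h4 | h4 <;>
  rcases le_total c' (polygonLength i w (j + 1)) with h5 | h5 <;>
  simp only [min_eq_left, min_eq_right, h2, h3, h4, h5] <;> linarith

theorem traversed_nonneg (i : Fin (n + 1)) (w : ℕ → Fin (n + 1)) (j : ℕ) (c : ℝ) :
    0 ≤ traversed i w j c :=
  sub_nonneg.2 (min_le_min_left _ (polygonLength_mono i w (Nat.le_succ j)))

theorem traversed_le (i : Fin (n + 1)) (w : ℕ → Fin (n + 1)) (j : ℕ) (c : ℝ) :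
    traversed i w j c ≤ edgeLength i w j := by
  have h1 := polygonLength_succ i w j
  have h2 := edgeLength_nonneg i w j
  unfold traversed
  rcases le_total c (polygonLength i w j) with h | h
  · rw [min_eq_left h, min_eq_left (by linarith)]; linarith
  · rw [min_eq_right h]
    linarith [min_le_right c (polygonLength i w (j + 1))]

theorem sum_traversed (i : Fin (n + 1)) (w : ℕ → Fin (n + 1)) (N : ℕ) (c : ℝ) :
    ∑ j ∈ Finset.range N, traversed i w j c = min c (polygonLength i w N) - min c 0 := by
  unfold traversed
  rw [Finset.sum_range_sub fun j => min c (polygonLength i w j)]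
  simp [polygonLength]

variable {q} in
-- At time `c` exactly one stretch of the polygon is being traversed; the increments of all
-- `traversed` terms are nonnegative and telescope to at most `c' - c`, while the directions have
-- norm at most one.
theorem dist_polygon_le (hq : UnitSides q) (i : Fin (n + 1)) (w : ℕ → Fin (n + 1)) (N : ℕ)
    {c c' : ℝ} (h0 : 0 ≤ c) (h : c ≤ c') :
    dist (polygon q i w N c) (polygon q i w N c') ≤ c' - c := by
  have hn : ∀ j, ‖q j - q i‖ ≤ 1 := fun j => by
    rw [← dist_eq_norm]
    by_cases hj : j = i
    · simp [hj]
    · exact (hq j i hj).le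
  unfold polygon
  rw [dist_comm, dist_add_left, dist_eq_norm, ← Finset.sum_sub_distrib]
  calc ‖∑ j ∈ Finset.range N, (traversed i w j c' • (q (w j) - q i) -
        traversed i w j c • (q (w j) - q i))‖
      ≤ ∑ j ∈ Finset.range N, (traversed i w j c' - traversed i w j c) := by
        refine norm_sum_le_of_le _ fun j _ => ?_
        have h1 := sub_nonneg.2 (traversed_mono i w j h)
        rw [← sub_smul, norm_smul, Real.norm_of_nonneg h1]
        exact mul_le_of_le_one_right h1 (hn _)
    _ ≤ c' - c := by
        rw [Finset.sum_sub_distrib, sum_traversed, sum_traversed, min_eq_right h0,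
          min_eq_right (h0.trans h)]
        rcases le_total c (polygonLength i w N) with h2 | h2
        · rw [min_eq_left h2]; linarith [min_le_left c' (polygonLength i w N)]
        · rw [min_eq_right h2]; linarith [min_le_right c' (polygonLength i w N)]

/-- The first edge lies on an edge of the simplex. Beyond it, the polygon is the image under `F_{w
0}` of the polygon of the shifted address, run at double speed, which allows induction on the number
of edges. -/
theorem polygon_mem_gasket (i : Fin (n + 1)) (N : ℕ) :
    ∀ (w : ℕ → Fin (n + 1)) (c : ℝ), 0 ≤ c → polygon q i w N c ∈ gasket q := by
  induction N with
  | zero => intro w c _; simpa [polygon] using vertex_mem_gasket q i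
  | succ N ih =>
    intro w c hc
    have h1 : polygonLength i w 1 = edgeLength i w 0 := by simp [polygonLength]
    have h0 : polygonLength i w 0 = 0 := by simp [polygonLength]
    unfold polygon
    rw [Finset.sum_range_succ']
    rcases le_total (edgeLength i w 0) c with h | h
    · have h2 : traversed i w 0 c • (q (w 0) - q i) = (1 / 2 : ℝ) • (q (w 0) - q i) := by
        unfold traversed
        rw [h1, h0, min_eq_right h, min_eq_right hc, sub_zero, edgeLength]
        split_ifs with hw
        · simp [hw]
        · simp
      have h3 : ∀ j, traversed i w (j + 1) c =
          1 / 2 * traversed i (fun j => w (j + 1)) j (2 * (c - edgeLength i w 0)) := by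
        intro j
        have hm : ∀ x, min c (edgeLength i w 0 + 1 / 2 * x) =
            edgeLength i w 0 + 1 / 2 * min (2 * (c - edgeLength i w 0)) x := by
          intro x
          rw [mul_min_of_nonneg _ _ (by norm_num), ← min_add_add_left]
          congr 1; ring
        unfold traversed
        rw [polygonLength_cons i w (j + 1), polygonLength_cons i w j, hm, hm]; ring
      have h4 := contraction_mem_gasket q (w 0)
        (ih (fun j => w (j + 1)) (2 * (c - edgeLength i w 0)) (by linarith))
      convert h4 using 1
      unfold polygon contraction
      simp only [h2, h3, mul_smul, ← Finset.smul_sum]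
      module
    · have h2 : ∀ j, traversed i w (j + 1) c = 0 := by
        intro j
        have h3 : polygonLength i w 1 ≤ polygonLength i w (j + 1) :=
          polygonLength_mono i w (by omega)
        have h4 := polygonLength_mono i w (Nat.le_succ (j + 1))
        unfold traversed
        rw [min_eq_left (by linarith), min_eq_left (by linarith), sub_self]
      simp only [h2, zero_smul, Finset.sum_const_zero, zero_add]
      refine edge_subset_gasket q i (w 0) ⟨traversed_nonneg _ _ _ _, ?_⟩
      exact (traversed_le _ _ _ _).trans ((edgeLength_le _ _ _).trans (by norm_num))

variable {q} in
/-- Every point of the gasket is joined to the vertex `q i` by a curve of length `1 - [x]_i`. -/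
theorem exists_curve_from_vertex (hq : UnitSides q) (i : Fin (n + 1))
    {x : EuclideanSpace ℝ (Fin n)} (hx : x ∈ gasket q) :
    ∃ γ : ℝ → EuclideanSpace ℝ (Fin n), LipschitzOnWith 1 γ (Icc 0 (1 - q.coord i x)) ∧
      MapsTo γ (Icc 0 (1 - q.coord i x)) (gasket q) ∧ γ 0 = q i ∧ γ (1 - q.coord i x) = x := by
  obtain ⟨w, rfl⟩ := hx
  have hn : ∀ j, ‖q j - q i‖ ≤ 1 := fun j => by
    rw [← dist_eq_norm]
    by_cases hj : j = i
    · simp [hj]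
    · exact (hq j i hj).le
  -- The letters different from `i` carry the weights complementary to those that sum to `[x]_i`.
  have hlen : HasSum (edgeLength i w) (1 - q.coord i (addressPoint q w)) := by
    have := hasSum_half_pow.sub (hasSum_coord_addressPoint q i w)
    refine (this.congr_fun ?_ : _)
    intro j; unfold edgeLength; split_ifs <;> simp
  have hle : ∀ N, polygonLength i w N ≤ 1 - q.coord i (addressPoint q w) := fun N =>
    sum_le_hasSum _ (fun j _ => edgeLength_nonneg i w j) hlen
  have hsum : ∀ c, Summable fun j => traversed i w j c • (q (w j) - q i) := fun c => by
    refine Summable.of_norm_bounded hlen.summable fun j => ?_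
    rw [norm_smul, Real.norm_of_nonneg (traversed_nonneg i w j c)]
    exact (mul_le_of_le_one_right (traversed_nonneg i w j c) (hn _)).trans (traversed_le i w j c)
  let γ : ℝ → EuclideanSpace ℝ (Fin n) := fun c =>
    q i + ∑' j, traversed i w j c • (q (w j) - q i)
  have hlim : ∀ c, Filter.Tendsto (fun N => polygon q i w N c) Filter.atTop (nhds (γ c)) :=
    fun c => tendsto_const_nhds.add (hsum c).hasSum.tendsto_sum_nat
  refine ⟨γ, ?_, fun c hc => ?_, ?_, ?_⟩
  · have key : ∀ c c', 0 ≤ c → c ≤ c' → dist (γ c) (γ c') ≤ c' - c := fun c c' h0 h =>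
      le_of_tendsto' ((hlim c).dist (hlim c')) fun N => dist_polygon_le hq i w N h0 h
    refine LipschitzOnWith.of_dist_le_mul fun c hc c' hc' => ?_
    rw [NNReal.coe_one, one_mul, Real.dist_eq]
    rcases le_total c c' with h | h
    · rw [abs_sub_comm, abs_of_nonneg (sub_nonneg.2 h)]; exact key _ _ hc.1 h
    · rw [dist_comm, abs_of_nonneg (sub_nonneg.2 h)]; exact key _ _ hc'.1 h
  · exact (gasket_isCompact q).isClosed.mem_of_tendsto (hlim c)
      (Filter.Eventually.of_forall fun N => polygon_mem_gasket q i N w c hc.1)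
  · have h : ∀ j, traversed i w j 0 = 0 := fun j => by
      have hp : ∀ N, 0 ≤ polygonLength i w N := fun N =>
        Finset.sum_nonneg fun j _ => edgeLength_nonneg i w j
      unfold traversed
      rw [min_eq_left (hp _), min_eq_left (hp _), sub_self]
    simp [γ, h]
  · have h : ∀ j, traversed i w j (1 - q.coord i (addressPoint q w)) • (q (w j) - q i) =
        (1 / 2 : ℝ) ^ (j + 1) • q (w j) - (1 / 2 : ℝ) ^ (j + 1) • q i := fun j => by
      unfold traversed
      rw [min_eq_right (hle _), min_eq_right (hle _), polygonLength_succ, add_sub_cancel_left,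
        ← smul_sub, edgeLength]
      split_ifs with hw
      · simp [hw]
      · rfl
    have h2 := (summable_address q w).hasSum.sub (hasSum_half_pow.smul_const (q i))
    simp only [γ, h, h2.tsum_eq, one_smul]
    simp [addressPoint]

/-! ### The intrinsic metric -/

/-- Length depends only on the image, so curves on arbitrary intervals may compete; pieces and
concatenations need no further reparametrization. -/
theorem intrinsicDist_le {γ : ℝ → EuclideanSpace ℝ (Fin n)} {a b : ℝ} (hab : a ≤ b)
    (hγ : ContinuousOn γ (Icc a b)) (hS : MapsTo γ (Icc a b) (gasket q)) :
    intrinsicDist q (γ a) (γ b) ≤ Measure.hausdorffMeasure 1 (γ '' Icc a b) := by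
  have hm : MapsTo (fun s : ℝ => a + s * (b - a)) (Icc 0 1) (Icc a b) := fun s hs =>
    ⟨by nlinarith [hs.1], by nlinarith [hs.2]⟩
  have hp : IsPath q (γ ∘ fun s : ℝ => a + s * (b - a)) (γ a) (γ b) :=
    ⟨hγ.comp (by fun_prop) hm, hS.comp hm, by simp, by simp⟩
  unfold intrinsicDist
  refine iInf₂_le_of_le _ hp ?_
  unfold pathLength
  rw [image_comp]
  exact measure_mono (image_mono hm.image_subset)

theorem intrinsicDist_comm (x y : EuclideanSpace ℝ (Fin n)) :
    intrinsicDist q x y = intrinsicDist q y x := by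
  have key : ∀ x y, intrinsicDist q x y ≤ intrinsicDist q y x := by
    intro x y
    refine le_iInf₂ fun γ hγ => ?_
    obtain ⟨h1, h2, h3, h4⟩ := hγ
    have hm : MapsTo (fun s : ℝ => 1 - s) (Icc 0 1) (Icc 0 1) := fun s hs =>
      ⟨by linarith [hs.2], by linarith [hs.1]⟩
    have h5 := intrinsicDist_le q zero_le_one (h1.comp (by fun_prop) hm) (h2.comp hm)
    simp only [Function.comp, sub_zero, sub_self, h3, h4] at h5
    refine h5.trans ?_
    rw [← Function.comp_def γ, image_comp]
    exact measure_mono (image_mono hm.image_subset)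
  exact le_antisymm (key x y) (key y x)

theorem intrinsicDist_triangle (x y z : EuclideanSpace ℝ (Fin n)) :
    intrinsicDist q x z ≤ intrinsicDist q x y + intrinsicDist q y z := by
  unfold intrinsicDist
  simp only [ENNReal.iInf_add, ENNReal.add_iInf]
  refine le_iInf₂ fun δ hδ => le_iInf₂ fun γ hγ => ?_
  obtain ⟨h1, h2, h3, h4⟩ := hγ
  obtain ⟨k1, k2, k3, k4⟩ := hδ
  let ε : ℝ → EuclideanSpace ℝ (Fin n) := fun s => if s ≤ 1 then γ s else δ (s - 1)
  have e1 : EqOn ε γ (Icc 0 1) := fun s hs => if_pos hs.2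
  have e2 : EqOn ε (δ ∘ fun s => s - 1) (Icc 1 2) := by
    intro s hs
    rcases hs.1.eq_or_lt with rfl | h
    · simp [ε, h4, k3]
    · exact if_neg (not_le.2 h)
  have hm : MapsTo (fun s : ℝ => s - 1) (Icc 1 2) (Icc 0 1) := fun s hs =>
    ⟨by linarith [hs.1], by linarith [hs.2]⟩
  have hu : Icc (0 : ℝ) 2 = Icc 0 1 ∪ Icc 1 2 :=
    (Icc_union_Icc_eq_Icc (by norm_num) (by norm_num)).symm
  have hc : ContinuousOn ε (Icc 0 2) := by
    rw [hu]
    exact (h1.congr e1).union_of_isClosed ((k1.comp (by fun_prop) hm).congr e2) isClosed_Icc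
      isClosed_Icc
  have hS : MapsTo ε (Icc 0 2) (gasket q) := by
    rw [hu]
    exact (h2.congr e1.symm).union ((k2.comp hm).congr e2.symm)
  have h := intrinsicDist_le q (by norm_num) hc hS
  have hε0 : ε 0 = x := by rw [e1 (by simp), h3]
  have hε2 : ε 2 = z := by rw [e2 (by norm_num)]; norm_num [k4]
  rw [hε0, hε2] at h
  refine h.trans ?_
  rw [hu, image_union, e1.image_eq, e2.image_eq, image_comp]
  exact (measure_union_le _ _).trans (add_le_add_right (measure_mono (image_mono hm.image_subset)) _)

variable {q} in
theorem ofReal_coord_sub_le_intrinsicDist (hq : UnitSides q) (i : Fin (n + 1))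
    (x y : EuclideanSpace ℝ (Fin n)) :
    ENNReal.ofReal (q.coord i y - q.coord i x) ≤ intrinsicDist q x y := by
  refine le_iInf₂ fun γ hγ => ?_
  rw [← hγ.2.2.1, ← hγ.2.2.2]
  exact ofReal_coord_sub_le_hausdorff hq i zero_le_one hγ.1 hγ.2.1

/-! ### Cells -/

theorem wordMap_mem_gasket (w : List (Fin (n + 1))) {x : EuclideanSpace ℝ (Fin n)}
    (hx : x ∈ gasket q) : wordMap q w x ∈ gasket q := by
  induction w with
  | nil => exact hx
  | cons l w ih => exact contraction_mem_gasket q l ih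

theorem continuous_wordMap (w : List (Fin (n + 1))) : Continuous (wordMap q w) := by
  induction w with
  | nil => exact continuous_id
  | cons l w ih => exact (continuous_contraction q l).comp ih

theorem wordMap_injective (w : List (Fin (n + 1))) : Function.Injective (wordMap q w) := by
  induction w with
  | nil => exact Function.injective_id
  | cons l w ih => exact (contraction_injective q l).comp ih

theorem dist_wordMap (w : List (Fin (n + 1))) (x y : EuclideanSpace ℝ (Fin n)) :
    dist (wordMap q w x) (wordMap q w y) = (1 / 2) ^ w.length * dist x y := by
  induction w with
  | nil => simp [wordMap]
  | cons l w ih => rw [wordMap, wordMap, dist_contraction, ih, List.length_cons, pow_succ]; ring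

theorem coord_wordMap_sub (w : List (Fin (n + 1))) (i : Fin (n + 1))
    (x y : EuclideanSpace ℝ (Fin n)) :
    q.coord i (wordMap q w x) - q.coord i (wordMap q w y) =
      (1 / 2) ^ w.length * (q.coord i x - q.coord i y) := by
  induction w with
  | nil => simp [wordMap]
  | cons l w ih =>
    rw [wordMap, wordMap, coord_contraction, coord_contraction, List.length_cons, pow_succ]
    linear_combination (1 / 2) * ih

variable {q} in
/-- The intrinsic distance of a point of a cell to a boundary point of the cell. -/
theorem intrinsicDist_boundaryPoint (hq : UnitSides q) (w : List (Fin (n + 1))) (i : Fin (n + 1))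
    {x : EuclideanSpace ℝ (Fin n)} (hx : x ∈ gasket q) :
    intrinsicDist q (wordMap q w x) (boundaryPoint q w i) =
      ENNReal.ofReal ((1 / 2) ^ w.length * (1 - q.coord i x)) := by
  have h1 := coord_le_one q hx i
  refine le_antisymm ?_ ?_
  · obtain ⟨γ, hγ, hS, h0, hl⟩ := exists_curve_from_vertex hq i hx
    have hlip : LipschitzOnWith ((1 / 2) ^ w.length) (wordMap q w ∘ γ)
        (Icc 0 (1 - q.coord i x)) := by
      refine LipschitzOnWith.of_dist_le_mul fun c hc c' hc' => ?_
      rw [Function.comp_apply, Function.comp_apply, dist_wordMap]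
      push_cast
      gcongr
      simpa using hγ.dist_le_mul c hc c' hc'
    have h2 := intrinsicDist_le q (sub_nonneg.2 h1) hlip.continuousOn
      fun c hc => wordMap_mem_gasket q w (hS hc)
    rw [Function.comp_apply, Function.comp_apply, h0, hl, intrinsicDist_comm] at h2
    refine h2.trans ((hausdorff_image_le hlip).trans (le_of_eq ?_))
    rw [hausdorff_Icc, sub_zero, ENNReal.ofReal_mul (by positivity)]
    congr 1
    rw [ENNReal.ofReal_pow (by norm_num), ENNReal.ofReal_div_of_pos (by norm_num)]
    simp [ENNReal.inv_pow]
  · have h2 := ofReal_coord_sub_le_intrinsicDist hq i (wordMap q w x) (boundaryPoint q w i)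
    rwa [boundaryPoint, coord_wordMap_sub, q.coord_apply, if_pos rfl] at h2

variable {q}

/-! ### Geodesics -/

theorem IsGeodesic.hausdorff_image {γ : ℝ → EuclideanSpace ℝ (Fin n)}
    {a b : EuclideanSpace ℝ (Fin n)} (h : IsGeodesic q γ a b) {D : ℝ}
    (hD : intrinsicDist q a b = ENNReal.ofReal D) {t : ℝ} (ht : t ∈ Icc (0 : ℝ) 1) :
    Measure.hausdorffMeasure 1 (γ '' Icc 0 t) = ENNReal.ofReal (t * D) := by
  rw [h.2.1 t ht, h.2.2, hD, ENNReal.ofReal_mul ht.1]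

theorem IsGeodesic.intrinsicDist_left_le {γ : ℝ → EuclideanSpace ℝ (Fin n)}
    {a b : EuclideanSpace ℝ (Fin n)} (h : IsGeodesic q γ a b) {D : ℝ}
    (hD : intrinsicDist q a b = ENNReal.ofReal D) {t : ℝ} (ht : t ∈ Icc (0 : ℝ) 1) :
    intrinsicDist q a (γ t) ≤ ENNReal.ofReal (t * D) := by
  have hsub : Icc 0 t ⊆ Icc (0 : ℝ) 1 := Icc_subset_Icc_right ht.2
  rw [← h.hausdorff_image hD ht]
  have := intrinsicDist_le q ht.1 (h.1.1.mono hsub) (h.1.2.1.mono_left hsub)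
  rwa [h.1.2.2.1] at this

/-- A geodesic can be cut at its last return to an initial piece; minimality forces this return to
end at the end of the piece. -/
theorem IsGeodesic.intrinsicDist_right_le {γ : ℝ → EuclideanSpace ℝ (Fin n)}
    {a b : EuclideanSpace ℝ (Fin n)} (h : IsGeodesic q γ a b) {D : ℝ} (hD0 : 0 < D)
    (hD : intrinsicDist q a b = ENNReal.ofReal D) {t : ℝ} (ht : t ∈ Icc (0 : ℝ) 1) :
    intrinsicDist q (γ t) b ≤ ENNReal.ofReal ((1 - t) * D) := by
  obtain ⟨hγ, hS, h0, h1⟩ := h.1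
  have hsub : Icc 0 t ⊆ Icc (0 : ℝ) 1 := Icc_subset_Icc_right ht.2
  have hK : IsCompact (γ '' Icc 0 t) := isCompact_Icc.image_of_continuousOn (hγ.mono hsub)
  have hU : IsCompact (Icc t 1 ∩ γ ⁻¹' (γ '' Icc 0 t)) :=
    isCompact_Icc.of_isClosed_subset ((hγ.mono (Icc_subset_Icc_left
      ht.1)).preimage_isClosed_of_isClosed isClosed_Icc hK.isClosed) inter_subset_left
  obtain ⟨s, ⟨hs, s', hs', hss⟩, hmax⟩ := hU.exists_isGreatest
    ⟨t, left_mem_Icc.2 ht.2, mem_image_of_mem _ (right_mem_Icc.2 ht.1)⟩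
  have hsub' : Icc s 1 ⊆ Icc (0 : ℝ) 1 := Icc_subset_Icc_left (ht.1.trans hs.1)
  have h2 : Measure.hausdorffMeasure 1 (γ '' Icc s 1) ≤ ENNReal.ofReal ((1 - t) * D) := by
    -- After its last return at time `s` the curve meets `γ '' Icc 0 t` only in `γ s`. The two
    -- lengths therefore add, and at most `(1 - t) D` is left for the rest.
    have h3 := hausdorff_add_le (p := γ s) hK (image_mono (f := γ) hsub') (image_mono hsub) (by
      rintro _ ⟨⟨u, hu, rfl⟩, hu'⟩
      rw [le_antisymm (hmax ⟨⟨hs.1.trans hu.1, hu.2⟩, hu'⟩) hu.1]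
      rfl)
    rw [h.hausdorff_image hD ht, h.hausdorff_image hD (by simp), one_mul] at h3
    have h4 := ENNReal.le_sub_of_add_le_right ENNReal.ofReal_ne_top h3
    rwa [← ENNReal.ofReal_sub _ (mul_nonneg ht.1 hD0.le),
      show D - t * D = (1 - t) * D by ring] at h4
  have h5 := (intrinsicDist_le q hs.2 (hγ.mono hsub') (hS.mono_left hsub')).trans h2
  rw [h1] at h5
  -- The shortcut through `γ s' = γ s` omits the loop and costs at most `s' D + (1 - t) D`. As this
  -- cannot be less than `D`, it follows that `s' = t`.
  have h6 := (intrinsicDist_triangle q a (γ s') b).trans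
    (add_le_add (h.intrinsicDist_left_le hD (hsub hs')) (hss ▸ h5))
  rw [hD, ← ENNReal.ofReal_add (mul_nonneg hs'.1 hD0.le)
    (mul_nonneg (sub_nonneg.2 ht.2) hD0.le)] at h6
  have h7 := (ENNReal.ofReal_le_ofReal_iff (add_nonneg (mul_nonneg hs'.1 hD0.le)
    (mul_nonneg (sub_nonneg.2 ht.2) hD0.le))).1 h6
  have h8 : t ≤ s' := le_of_mul_le_mul_right (by linarith) hD0
  obtain rfl := le_antisymm h8 hs'.2
  rwa [hss]

theorem intrinsicDist_self {x : EuclideanSpace ℝ (Fin n)} (hx : x ∈ gasket q) :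
    intrinsicDist q x x = 0 := by
  have : NullSingletonClass (Measure.hausdorffMeasure 1 : Measure (EuclideanSpace ℝ (Fin n))) :=
    Measure.nullSingletonClass_hausdorff _ one_pos
  have h := intrinsicDist_le q (γ := fun _ => x) (a := 0) (b := 0) le_rfl continuousOn_const
    fun _ _ => hx
  simpa using h

theorem IsGeodesic.intrinsicDist_eq_left {γ : ℝ → EuclideanSpace ℝ (Fin n)}
    {a b : EuclideanSpace ℝ (Fin n)} (h : IsGeodesic q γ a b) {D : ℝ} (hD0 : 0 < D)
    (hD : intrinsicDist q a b = ENNReal.ofReal D) {t : ℝ} (ht : t ∈ Icc (0 : ℝ) 1) :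
    intrinsicDist q a (γ t) = ENNReal.ofReal (t * D) := by
  refine le_antisymm (h.intrinsicDist_left_le hD ht) ?_
  have h1 := (intrinsicDist_triangle q a (γ t) b).trans
    (add_le_add_right (h.intrinsicDist_right_le hD0 hD ht) _)
  rw [hD] at h1
  have h2 := tsub_le_iff_right.2 h1
  rwa [← ENNReal.ofReal_sub _ (mul_nonneg (sub_nonneg.2 ht.2) hD0.le),
    show D - (1 - t) * D = t * D by ring] at h2

/-- Along a geodesic the intrinsic distance is proportional to the time. -/
theorem IsGeodesic.intrinsicDist_eq {γ : ℝ → EuclideanSpace ℝ (Fin n)}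
    {a b : EuclideanSpace ℝ (Fin n)} (h : IsGeodesic q γ a b) {D : ℝ} (hD0 : 0 < D)
    (hD : intrinsicDist q a b = ENNReal.ofReal D) {s t : ℝ} (hs : 0 ≤ s) (hst : s ≤ t)
    (ht : t ≤ 1) : intrinsicDist q (γ s) (γ t) = ENNReal.ofReal ((t - s) * D) := by
  have ht' : t ∈ Icc (0 : ℝ) 1 := ⟨hs.trans hst, ht⟩
  have hs' : s ∈ Icc (0 : ℝ) 1 := ⟨hs, hst.trans ht⟩
  rcases ht'.1.eq_or_lt with h0 | h0
  · obtain rfl : s = t := by linarith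
    rw [intrinsicDist_self (h.1.2.1 hs')]; simp
  refine le_antisymm ?_ ?_
  · have himg : ∀ u, (fun s => γ (s * t)) '' Icc 0 u = γ '' Icc 0 (u * t) := by
      intro u
      rw [← Function.comp_def γ, image_comp, image_mul_right_Icc' _ _ h0, zero_mul]
    have hm : MapsTo (fun s => s * t) (Icc 0 1) (Icc 0 1) := fun u hu =>
      ⟨mul_nonneg hu.1 h0.le, mul_le_one₀ hu.2 h0.le ht⟩
    have hl : pathLength (fun s => γ (s * t)) = ENNReal.ofReal (t * D) := by
      rw [pathLength, himg, one_mul, h.hausdorff_image hD ht']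
    -- The initial piece is itself a geodesic, so the bound for the remaining distance applies to it
    -- at the time `s / t`.
    have hg : IsGeodesic q (fun s => γ (s * t)) a (γ t) := by
      refine ⟨⟨h.1.1.comp (by fun_prop) hm, h.1.2.1.comp hm, ?_, ?_⟩, fun u hu => ?_, ?_⟩
      · simp [h.1.2.2.1]
      · simp
      · rw [himg, hl, h.hausdorff_image hD (hm hu), ← ENNReal.ofReal_mul hu.1, mul_assoc]
      · rw [hl, h.intrinsicDist_eq_left hD0 hD ht']
    have h1 := hg.intrinsicDist_right_le (mul_pos h0 hD0)
      (h.intrinsicDist_eq_left hD0 hD ht') (t := s / t) ⟨by positivity, div_le_one_of_le₀ hst h0.le⟩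
    rw [div_mul_cancel₀ _ h0.ne', show (1 - s / t) * (t * D) = (t - s) * D by field_simp] at h1
    exact h1
  · have h1 := (intrinsicDist_triangle q a (γ s) (γ t)).trans
      (add_le_add_left (h.intrinsicDist_left_le hD hs') _)
    rw [h.intrinsicDist_eq_left hD0 hD ht'] at h1
    have h2 := tsub_le_iff_left.2 h1
    rwa [← ENNReal.ofReal_sub _ (mul_nonneg hs hD0.le), ← sub_mul] at h2

theorem IsGeodesic.injOn {γ : ℝ → EuclideanSpace ℝ (Fin n)}
    {a b : EuclideanSpace ℝ (Fin n)} (h : IsGeodesic q γ a b) {D : ℝ} (hD0 : 0 < D)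
    (hD : intrinsicDist q a b = ENNReal.ofReal D) : InjOn γ (Icc 0 1) := by
  have key : ∀ s ∈ Icc (0 : ℝ) 1, ∀ t ∈ Icc (0 : ℝ) 1, s < t → γ s ≠ γ t := by
    intro s hs t ht hst he
    have h1 := h.intrinsicDist_eq hD0 hD hs.1 hst.le ht.2
    rw [he, intrinsicDist_self (h.1.2.1 ht), eq_comm, ENNReal.ofReal_eq_zero] at h1
    nlinarith
  intro s hs t ht he
  rcases lt_trichotomy s t with h1 | h1 | h1
  · exact absurd he (key s hs t ht h1)
  · exact h1
  · exact absurd he.symm (key t ht s hs h1)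

/-- A path of length zero is constant, hence a piece of itself with entry time `1` as well as with
exit time `0`. This contradicts `t_1^f < t_2^i`. -/
theorem pathLength_pos_of_isRegularCommonPath {A B : Set (EuclideanSpace ℝ (Fin n))}
    {σ : ℝ → EuclideanSpace ℝ (Fin n)} (hσ : IsRegularCommonPath q A B σ)
    {a b : EuclideanSpace ℝ (Fin n)} (ha : a ∈ A) (hb : b ∈ B) (hg : IsGeodesic q σ a b) :
    pathLength σ ≠ 0 := by
  intro h0
  have hconst : ∀ s ∈ Icc (0 : ℝ) 1, ∀ t ∈ Icc (0 : ℝ) 1, σ s = σ t := by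
    intro s hs t ht
    have h1 := dist_le_hausdorff hg.1.1 hs ht
    rw [show Measure.hausdorffMeasure 1 (σ '' Icc 0 1) = 0 from h0] at h1
    exact dist_le_zero.1 (ENNReal.ofReal_eq_zero.1 (nonpos_iff_eq_zero.1 h1))
  have h1 : (1 : ℝ) ≤ finalEntryTime q A B σ :=
    le_csSup ⟨1, by rintro _ ⟨_, _, _, _, _, _, _, hp⟩; exact hp.2.1.trans hp.2.2.1⟩
      ⟨a, ha, b, hb, σ, 1, hg, zero_le_one, le_rfl, le_rfl, fun u hu =>
        hconst _ hu _ (by simp)⟩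
  have h2 : initialExitTime q A B σ ≤ 0 :=
    csInf_le ⟨0, by rintro _ ⟨_, _, _, _, _, _, _, hp⟩; exact hp.1.trans hp.2.1⟩
      ⟨a, ha, b, hb, σ, 0, hg, le_rfl, le_rfl, zero_le_one, fun u hu =>
        hconst _ hu _ (by simp)⟩
  linarith [hσ.2.2]

theorem IsPiece.mem_Icc {A B : Set (EuclideanSpace ℝ (Fin n))}
    {σ γ : ℝ → EuclideanSpace ℝ (Fin n)} {a b : EuclideanSpace ℝ (Fin n)} (ha : a ∈ A)
    (hb : b ∈ B) (hg : IsGeodesic q γ a b) {t₁ t₂ t : ℝ} (hp : IsPiece σ γ t₁ t₂)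
    (ht : t ∈ Icc (finalEntryTime q A B σ) (initialExitTime q A B σ)) : t ∈ Icc t₁ t₂ := by
  have h1 : t₁ ≤ finalEntryTime q A B σ :=
    le_csSup ⟨1, by rintro _ ⟨_, _, _, _, _, _, _, hp⟩; exact hp.2.1.trans hp.2.2.1⟩
      ⟨a, ha, b, hb, γ, t₂, hg, hp⟩
  have h2 : initialExitTime q A B σ ≤ t₂ :=
    csInf_le ⟨0, by rintro _ ⟨_, _, _, _, _, _, _, hp⟩; exact hp.1.trans hp.2.1⟩
      ⟨a, ha, b, hb, γ, t₁, hg, hp⟩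
  exact ⟨h1.trans ht.1, ht.2.trans h2⟩

/-- The position on the common path `σ` at a time between entry and exit. -/
theorem IsPiece.apply_eq (hq : UnitSides q) {w v : List (Fin (n + 1))} {i j : Fin (n + 1)}
    {σ γ : ℝ → EuclideanSpace ℝ (Fin n)} {L : ℝ} (hL0 : 0 < L)
    (hL : pathLength σ = ENNReal.ofReal L)
    (hσ : IsGeodesic q σ (boundaryPoint q w i) (boundaryPoint q v j))
    {x y : EuclideanSpace ℝ (Fin n)} (hx : x ∈ gasket q) (hy : y ∈ gasket q)
    (hγ : IsGeodesic q γ (wordMap q w x) (wordMap q v y)) {t₁ t₂ t : ℝ}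
    (hp : IsPiece σ γ t₁ t₂) (ht : t ∈ Icc t₁ t₂) :
    t + ((1 / 2) ^ v.length * t * (1 - q.coord j y) -
        (1 / 2) ^ w.length * (1 - t) * (1 - q.coord i x)) / L ∈ Icc (0 : ℝ) 1 ∧
    γ t = σ (t + ((1 / 2) ^ v.length * t * (1 - q.coord j y) -
      (1 / 2) ^ w.length * (1 - t) * (1 - q.coord i x)) / L) := by
  set α := (1 / 2) ^ w.length * (1 - q.coord i x) with hα
  set β := (1 / 2) ^ v.length * (1 - q.coord j y) with hβ
  have hα0 : 0 ≤ α := mul_nonneg (by positivity) (sub_nonneg.2 (coord_le_one q hx i))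
  have hβ0 : 0 ≤ β := mul_nonneg (by positivity) (sub_nonneg.2 (coord_le_one q hy j))
  have hdα : intrinsicDist q (wordMap q w x) (boundaryPoint q w i) = ENNReal.ofReal α :=
    intrinsicDist_boundaryPoint hq w i hx
  have hdβ : intrinsicDist q (boundaryPoint q v j) (wordMap q v y) = ENNReal.ofReal β := by
    rw [intrinsicDist_comm]; exact intrinsicDist_boundaryPoint hq v j hy
  have hdL : intrinsicDist q (boundaryPoint q w i) (boundaryPoint q v j) = ENNReal.ofReal L := by
    rw [← hσ.2.2, hL]
  obtain ⟨h0, h12, h1, hpu⟩ := hp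
  have hγ1 : γ t₁ = boundaryPoint q w i := by
    have := hpu 0 (by simp)
    rw [hσ.1.2.2.1] at this
    rw [this]; simp
  have hγ2 : γ t₂ = boundaryPoint q v j := by
    have := hpu 1 (by simp)
    rw [hσ.1.2.2.2] at this
    rw [this]; simp
  have hfin : intrinsicDist q (wordMap q w x) (wordMap q v y) ≠ ∞ := by
    refine ne_top_of_le_ne_top ?_ ((intrinsicDist_triangle q _ (boundaryPoint q w i) _).trans
      (add_le_add_right (intrinsicDist_triangle q _ (boundaryPoint q v j) _) _))
    rw [hdα, hdβ, hdL]
    simp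
  obtain ⟨D, hD⟩ : ∃ D : ℝ, intrinsicDist q (wordMap q w x) (wordMap q v y) =
      ENNReal.ofReal D := ⟨_, (ENNReal.ofReal_toReal hfin).symm⟩
  -- The image of `σ` is part of the image of `γ`. This makes `D` positive, as the distance formulas
  -- along geodesics require.
  have hLD : L ≤ D := by
    have h2 : pathLength σ ≤ pathLength γ := by
      refine measure_mono ?_
      rintro _ ⟨u, hu, rfl⟩
      rw [hpu u hu]
      exact mem_image_of_mem _ ⟨by nlinarith [hu.1], by nlinarith [hu.2]⟩
    rw [hL, hγ.2.2, hD] at h2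
    rcases le_or_gt D 0 with h3 | h3
    · rw [ENNReal.ofReal_of_nonpos h3, nonpos_iff_eq_zero, ENNReal.ofReal_eq_zero] at h2
      linarith
    · exact (ENNReal.ofReal_le_ofReal_iff h3.le).1 h2
  have hD0 : 0 < D := hL0.trans_le hLD
  -- The three pieces of `γ` have lengths `α`, `L`, `β`. Dividing by `D` determines the entry and
  -- exit times, and with them the position `(t - t₁) / (t₂ - t₁)` on `σ`.
  have e1 : t₁ * D = α := by
    have h2 := hγ.intrinsicDist_eq_left hD0 hD (t := t₁) ⟨h0, h12.trans h1⟩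
    rw [hγ1, hdα] at h2
    exact ((ENNReal.ofReal_eq_ofReal_iff hα0 (mul_nonneg h0 hD0.le)).1 h2).symm
  have e2 : (t₂ - t₁) * D = L := by
    have h2 := hγ.intrinsicDist_eq hD0 hD h0 h12 h1
    rw [hγ1, hγ2, hdL] at h2
    exact ((ENNReal.ofReal_eq_ofReal_iff hL0.le
      (mul_nonneg (sub_nonneg.2 h12) hD0.le)).1 h2).symm
  have e3 : (1 - t₂) * D = β := by
    have h2 := hγ.intrinsicDist_eq hD0 hD (h0.trans h12) h1 le_rfl
    rw [hγ2, hγ.1.2.2.2, hdβ] at h2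
    exact ((ENNReal.ofReal_eq_ofReal_iff hβ0
      (mul_nonneg (sub_nonneg.2 h1) hD0.le)).1 h2).symm
  have h21 : 0 < t₂ - t₁ := pos_of_mul_pos_left (e2 ▸ hL0) hD0.le
  have hu : t + ((1 / 2) ^ v.length * t * (1 - q.coord j y) -
      (1 / 2) ^ w.length * (1 - t) * (1 - q.coord i x)) / L = (t - t₁) / (t₂ - t₁) := by
    rw [show (1 / 2) ^ v.length * t * (1 - q.coord j y) = t * β by rw [hβ]; ring,
      show (1 / 2) ^ w.length * (1 - t) * (1 - q.coord i x) = (1 - t) * α by rw [hα]; ring,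
      ← e1, ← e2, ← e3]
    field_simp
    ring
  have hmem : (t - t₁) / (t₂ - t₁) ∈ Icc (0 : ℝ) 1 :=
    ⟨div_nonneg (sub_nonneg.2 ht.1) h21.le, (div_le_one h21).2 (by linarith [ht.2])⟩
  rw [hu]
  refine ⟨hmem, ?_⟩
  rw [hpu _ hmem, div_mul_cancel₀ _ h21.ne']
  ring_nf

variable (q)

/-! ### The standard measure on cells -/

theorem stdMeasure_compl_gasket : stdMeasure q (gasket q)ᶜ = 0 := by
  rw [stdMeasure, Measure.map_apply (addressPoint_continuous q).measurable
    (gasket_isCompact q).isClosed.measurableSet.compl]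
  convert measure_empty (μ := addressMeasure n)
  ext w
  simp [gasket]

theorem ae_mem_gasket : ∀ᵐ x ∂stdMeasure q, x ∈ gasket q := stdMeasure_compl_gasket q

/-- Only `F_i` takes a gasket point to `q i`, namely `q i` itself. Self-similarity makes the mass
equal to `1/(n+1)` times itself, and it is finite. -/
theorem stdMeasure_vertex (hn : 1 ≤ n) (i : Fin (n + 1)) : stdMeasure q {q i} = 0 := by
  have h := stdMeasure_selfSimilar q (measurableSet_singleton (q i))
  rw [Finset.sum_eq_single i] at h
  · have h1 : contraction q i ⁻¹' {q i} = {q i} := by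
      ext x
      rw [mem_preimage, mem_singleton_iff, mem_singleton_iff]
      have h2 := (contraction_injective q i).eq_iff (a := x) (b := q i)
      rwa [contraction_vertex_self] at h2
    rw [h1] at h
    by_contra h0
    have h2 : ((n : ℝ≥0∞) + 1)⁻¹ * stdMeasure q {q i} < 1 * stdMeasure q {q i} := by
      refine ENNReal.mul_lt_mul_left h0 (measure_ne_top _ _) ?_
      rw [ENNReal.inv_lt_one]
      exact_mod_cast (by omega : 1 < n + 1)
    rw [one_mul, ← h] at h2
    exact lt_irrefl _ h2
  · intro l _ hl
    rw [measure_mono_null _ (stdMeasure_compl_gasket q), mul_zero]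
    intro x hx hxS
    have h1 := congrArg (q.coord i) (mem_singleton_iff.1 hx)
    rw [coord_contraction, if_neg hl.symm, q.coord_apply, if_pos rfl] at h1
    linarith [coord_le_one q hxS i]
  · simp

theorem cell_cons (l : Fin (n + 1)) (w : List (Fin (n + 1))) :
    cell q (l :: w) = contraction q l '' cell q w := by
  unfold cell; rw [image_image]; rfl

theorem isCompact_cell (w : List (Fin (n + 1))) : IsCompact (cell q w) :=
  (gasket_isCompact q).image (continuous_wordMap q w)

theorem cell_subset_gasket (w : List (Fin (n + 1))) : cell q w ⊆ gasket q := by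
  rintro _ ⟨x, hx, rfl⟩; exact wordMap_mem_gasket q w hx

/-- Self-similarity peels off the first letter: the preimage of the cell under any other contraction
contains at most one vertex within the gasket, which is null. -/
theorem stdMeasure_inter_cell (hn : 1 ≤ n) (w : List (Fin (n + 1))) :
    ∀ X, MeasurableSet X → stdMeasure q (X ∩ cell q w) =
      (((n : ℝ≥0∞) + 1)⁻¹) ^ w.length * stdMeasure q (wordMap q w ⁻¹' X) := by
  induction w with
  | nil =>
    intro X _
    have h1 : cell q [] = gasket q := image_id _
    have h2 : wordMap q ([] : List (Fin (n + 1))) ⁻¹' X = X := rfl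
    rw [h1, h2, List.length_nil, pow_zero, one_mul]
    exact measure_inter_conull (stdMeasure_compl_gasket q)
  | cons l w ih =>
    intro X hX
    rw [stdMeasure_selfSimilar q (hX.inter (isCompact_cell q _).isClosed.measurableSet),
      Finset.sum_eq_single l]
    · rw [preimage_inter, cell_cons, preimage_image_eq _ (contraction_injective q l),
        ih _ (hX.preimage (continuous_contraction q l).measurable), List.length_cons, pow_succ',
        mul_assoc]
      rfl
    · intro j _ hj
      rw [measure_mono_null _ (measure_union_null (stdMeasure_vertex q hn l)
        (stdMeasure_compl_gasket q)), mul_zero]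
      rintro x ⟨_, hx⟩
      by_cases hxS : x ∈ gasket q
      · left
        rw [cell_cons] at hx
        have h1 := inter_image_contraction q hj
          ⟨mem_image_of_mem _ hxS, image_mono (cell_subset_gasket q w) hx⟩
        exact contraction_injective q j h1
      · right; exact hxS
    · simp

theorem stdMeasure_restrict_cell (hn : 1 ≤ n) (w : List (Fin (n + 1))) :
    (stdMeasure q).restrict (cell q w) =
      (((n : ℝ≥0∞) + 1)⁻¹) ^ w.length • (stdMeasure q).map (wordMap q w) := by
  ext X hX
  rw [Measure.restrict_apply hX, Measure.smul_apply,
    Measure.map_apply (continuous_wordMap q w).measurable hX, smul_eq_mul,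
    stdMeasure_inter_cell q hn w X hX]

/-! ### Symmetry of the standard measure -/

theorem letterMeasure_map_perm (e : Equiv.Perm (Fin (n + 1))) :
    (letterMeasure n).map e = letterMeasure n := by
  ext s hs
  rw [Measure.map_apply (measurable_of_countable _) hs, letterMeasure_apply, letterMeasure_apply]
  exact Equiv.sum_comp e fun i => ((n : ℝ≥0∞) + 1)⁻¹ * s.indicator 1 i

theorem addressMeasure_map_perm (e : Equiv.Perm (Fin (n + 1))) :
    (addressMeasure n).map (fun w j => e (w j)) = addressMeasure n := by
  unfold addressMeasure
  rw [Measure.infinitePi_map_pi (fun _ => letterMeasure n) (f := fun _ => e)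
    fun _ => measurable_of_countable _]
  simp only [letterMeasure_map_perm]

/-- All barycentric coordinates have the same law. -/
theorem stdMeasure_map_coord (i : Fin (n + 1)) :
    (stdMeasure q).map (q.coord i) = baryMeasure q := by
  have hm := (addressPoint_continuous q).measurable
  have he : Measurable fun (w : ℕ → Fin (n + 1)) j => Equiv.swap i 0 (w j) :=
    measurable_pi_lambda _ fun j => (measurable_of_countable _).comp (measurable_pi_apply j)
  unfold baryMeasure stdMeasure
  rw [Measure.map_map (continuous_coord q i).measurable hm,
    Measure.map_map (continuous_coord q 0).measurable hm]
  -- Exchanging the letters `i` and `0` preserves the law of the address and turns the series of the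
  -- `i`-th coordinate into that of the coordinate `0`.
  nth_rewrite 2 [← addressMeasure_map_perm (Equiv.swap i 0)]
  rw [Measure.map_map ((continuous_coord q 0).measurable.comp hm) he]
  congr 1
  funext w
  refine (hasSum_coord_addressPoint q i w).unique ?_
  refine (hasSum_coord_addressPoint q 0 _).congr_fun fun j => ?_
  have : (0 = Equiv.swap i 0 (w j)) ↔ i = w j := by
    rw [eq_comm, Equiv.swap_apply_eq_iff, Equiv.swap_apply_right, eq_comm]
  simp only [this]

/-! ### Factorization through the unit square -/

variable {q}

/-- The coordinate runs through `[0,1]` along an edge ending in `q i`; a second vertex exists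
because `n ≥ 1`. -/
theorem exists_coord_eq (hn : 1 ≤ n) (i : Fin (n + 1)) {s : ℝ} (hs : s ∈ Icc (0 : ℝ) 1) :
    ∃ x ∈ gasket q, q.coord i x = s := by
  have : Nontrivial (Fin (n + 1)) := Fin.nontrivial_iff_two_le.2 (by omega)
  obtain ⟨l, hl⟩ := exists_ne i
  refine ⟨_, edge_subset_gasket q l i hs, ?_⟩
  have h : q l + s • (q i - q l) = AffineMap.lineMap (q l) (q i) s := by
    rw [AffineMap.lineMap_apply_module']; exact add_comm _ _
  rw [h, AffineMap.apply_lineMap, AffineMap.lineMap_apply_module, q.coord_apply, q.coord_apply,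
    if_neg hl.symm, if_pos rfl]
  simp

theorem pairMeasure_cell (hn : 1 ≤ n) (w v : List (Fin (n + 1))) :
    pairMeasure q (cell q w) (cell q v) =
      (((n : ℝ≥0∞) + 1) ^ (w.length + v.length))⁻¹ •
        ((stdMeasure q).prod (stdMeasure q)).map (Prod.map (wordMap q w) (wordMap q v)) := by
  rw [pairMeasure, ← Measure.prod_restrict, stdMeasure_restrict_cell q hn,
    stdMeasure_restrict_cell q hn, Measure.prod_smul_left, Measure.prod_smul_right, smul_smul,
    Measure.map_prod_map _ _ (continuous_wordMap q w).measurable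
    (continuous_wordMap q v).measurable, ← pow_add, ENNReal.inv_pow]

theorem baryMeasure_prod (i j : Fin (n + 1)) :
    (baryMeasure q).prod (baryMeasure q) =
      ((stdMeasure q).prod (stdMeasure q)).map (Prod.map (q.coord i) (q.coord j)) := by
  rw [← Measure.map_prod_map _ _ (continuous_coord q i).measurable
    (continuous_coord q j).measurable, stdMeasure_map_coord, stdMeasure_map_coord]

theorem ae_mem_gasket_prod :
    ∀ᵐ p ∂(stdMeasure q).prod (stdMeasure q), p.1 ∈ gasket q ∧ p.2 ∈ gasket q :=
  (Measure.quasiMeasurePreserving_fst.ae (ae_mem_gasket q)).and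
    (Measure.quasiMeasurePreserving_snd.ae (ae_mem_gasket q))

theorem measurable_squareMap (k m : ℕ) (t : ℝ) : Measurable (squareMap k m t) := by
  unfold squareMap; fun_prop

theorem squareMap_mem_Icc (k m : ℕ) {t : ℝ} (ht : t ∈ Icc (0 : ℝ) 1) {p : ℝ × ℝ}
    (h1 : p.1 ∈ Icc (0 : ℝ) 1) (h2 : p.2 ∈ Icc (0 : ℝ) 1) :
    squareMap k m t p ∈ Icc (0 : ℝ) 1 := by
  have hk : 0 ≤ (1 / 2 : ℝ) ^ k * (1 - t) := mul_nonneg (by positivity) (sub_nonneg.2 ht.2)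
  have hm : 0 ≤ (1 / 2 : ℝ) ^ m * t := mul_nonneg (by positivity) ht.1
  unfold squareMap
  refine ⟨div_nonneg (add_nonneg (mul_nonneg hk h1.1) (mul_nonneg hm (sub_nonneg.2 h2.2)))
    (add_nonneg hk hm), div_le_one_of_le₀ ?_ (add_nonneg hk hm)⟩
  exact add_le_add (mul_le_of_le_one_right hk h1.2)
    (mul_le_of_le_one_right hm (by linarith [h2.1]))

theorem squareMap_weight_pos (k m : ℕ) {t : ℝ} (ht : t ∈ Icc (0 : ℝ) 1) :
    0 < (1 / 2 : ℝ) ^ k * (1 - t) + (1 / 2) ^ m * t := by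
  have hk : (0 : ℝ) < (1 / 2) ^ k := by positivity
  have hm : (0 : ℝ) < (1 / 2) ^ m := by positivity
  rcases ht.1.eq_or_lt with h | h
  · rw [← h]; simp
  · nlinarith [mul_pos hm h, mul_nonneg hk.le (sub_nonneg.2 ht.2)]

/-- Measurability and pushforwards, once the interpolant is known to factor through the square. -/
theorem interpolatingMeasure_eq_of_factor (hn : 1 ≤ n) {k m : ℕ} {w v : List (Fin (n + 1))}
    (hw : w.length = k) (hv : v.length = m) {i j : Fin (n + 1)}
    {G : EuclideanSpace ℝ (Fin n) → EuclideanSpace ℝ (Fin n) → ℝ → EuclideanSpace ℝ (Fin n)}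
    {t : ℝ} (ht : t ∈ Icc (0 : ℝ) 1) {H : ℝ → EuclideanSpace ℝ (Fin n)}
    (hH : ContinuousOn H (Icc 0 1))
    (hG : ∀ x ∈ gasket q, ∀ y ∈ gasket q, interpolant G t (wordMap q w x, wordMap q v y) =
      H (squareMap k m t (q.coord i x, q.coord j y))) :
    AEMeasurable (interpolant G t) (pairMeasure q (cell q w) (cell q v)) ∧
    AEMeasurable H (((baryMeasure q).prod (baryMeasure q)).map (squareMap k m t)) ∧
    interpolatingMeasure q (cell q w) (cell q v) G t = ((n + 1 : ℝ≥0∞) ^ (k + m))⁻¹ •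
      (((baryMeasure q).prod (baryMeasure q)).map (squareMap k m t)).map H := by
  have hψ := measurable_squareMap k m t
  have hc : Measurable (Prod.map (q.coord i) (q.coord j)) :=
    (continuous_coord q i).measurable.prodMap (continuous_coord q j).measurable
  -- The selection is arbitrary outside the cells, so `interpolant G t` is known only after
  -- composition with the cell maps. Being an embedding, their product transfers a.e. measurability
  -- to the image measure.
  have hF : MeasurableEmbedding (Prod.map (wordMap q w) (wordMap q v)) :=
    ((continuous_wordMap q w).prodMap (continuous_wordMap q v)).measurableEmbedding
      ((wordMap_injective q w).prodMap (wordMap_injective q v))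
  have hmeas : AEMeasurable H (((baryMeasure q).prod (baryMeasure q)).map (squareMap k m t)) := by
    -- `H` is controlled on `[0,1]` only. Its constant extension past the endpoints is continuous,
    -- and the measure in question is carried by `[0,1]`.
    refine ⟨IccExtend (zero_le_one (α := ℝ)) ((Icc 0 1).domRestrict H),
      (hH.domRestrict.Icc_extend' (h := zero_le_one)).measurable, ?_⟩
    have hI : ∀ᵐ s ∂(((baryMeasure q).prod (baryMeasure q)).map (squareMap k m t)),
        s ∈ Icc (0 : ℝ) 1 := by
      rw [baryMeasure_prod i j, Measure.map_map hψ hc]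
      refine (ae_map_iff (hψ.comp hc).aemeasurable measurableSet_Icc).2 ?_
      filter_upwards [ae_mem_gasket_prod (q := q)] with p hp
      exact squareMap_mem_Icc k m ht ⟨coord_nonneg q hp.1 i, coord_le_one q hp.1 i⟩
        ⟨coord_nonneg q hp.2 j, coord_le_one q hp.2 j⟩
    filter_upwards [hI] with s hs
    rw [IccExtend_of_mem _ _ hs, domRestrict_apply]
  have hmeas' := hmeas
  rw [baryMeasure_prod i j, Measure.map_map hψ hc] at hmeas'
  have hae : interpolant G t ∘ Prod.map (wordMap q w) (wordMap q v)
      =ᵐ[(stdMeasure q).prod (stdMeasure q)]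
      H ∘ squareMap k m t ∘ Prod.map (q.coord i) (q.coord j) := by
    filter_upwards [ae_mem_gasket_prod (q := q)] with p hp
    exact hG p.1 hp.1 p.2 hp.2
  have hcomp : AEMeasurable (interpolant G t ∘ Prod.map (wordMap q w) (wordMap q v))
      ((stdMeasure q).prod (stdMeasure q)) :=
    (hmeas'.comp_measurable (hψ.comp hc)).congr hae.symm
  have hZ := hF.aemeasurable_map_iff.2 hcomp
  refine ⟨?_, hmeas, ?_⟩
  · rw [pairMeasure_cell hn]
    exact hZ.smul_measure _
  · rw [interpolatingMeasure, pairMeasure_cell hn, Measure.map_smul, hw, hv]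
    congr 1
    rw [AEMeasurable.map_map_of_aemeasurable hZ hF.measurable.aemeasurable, Measure.map_congr hae,
      baryMeasure_prod i j, Measure.map_map hψ hc,
      AEMeasurable.map_map_of_aemeasurable hmeas' (hψ.comp hc).aemeasurable]

/-- The affine position on the common path as a function on the unit square. -/
theorem position_eq (k m : ℕ) {t : ℝ} (ht : t ∈ Icc (0 : ℝ) 1) (L X Y : ℝ) :
    t + ((1 / 2) ^ m * t * (1 - Y) - (1 / 2) ^ k * (1 - t) * (1 - X)) / L =
      (t - (1 / 2) ^ k * (1 - t) / L) +
        squareMap k m t (X, Y) * (((1 / 2) ^ k * (1 - t) + (1 / 2) ^ m * t) / L) := by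
  have hW := (squareMap_weight_pos k m ht).ne'
  rw [squareMap, ← mul_div_assoc, div_mul_cancel₀ _ hW]
  ring

end SierpinskiGasket

/-! ### The interval of parameters and the interpolating measure -/

theorem mainTheorem7 (n : ℕ) (hn : 1 ≤ n)
    (q : AffineBasis (Fin (n + 1)) ℝ (EuclideanSpace ℝ (Fin n))) (hq : UnitSides q)
    (k m : ℕ) (w v : List (Fin (n + 1))) (hw : w.length = k) (hv : v.length = m)
    (A B : Set (EuclideanSpace ℝ (Fin n))) (hA : A = cell q w) (hB : B = cell q v)
    (i j : Fin (n + 1))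
    (σ : ℝ → EuclideanSpace ℝ (Fin n))
    (hσ : IsRegularCommonPath q A B σ)
    (hσu : IsUniqueGeodesic q σ (boundaryPoint q w i) (boundaryPoint q v j))
    (G : EuclideanSpace ℝ (Fin n) → EuclideanSpace ℝ (Fin n) → ℝ → EuclideanSpace ℝ (Fin n))
    (hG : IsGeodesicSelection q A B σ G)
    (t : ℝ) (ht : t ∈ Icc (finalEntryTime q A B σ) (initialExitTime q A B σ))
    (Z : Set (EuclideanSpace ℝ (Fin n))) (hZ : Z = interpolant G t '' (A ×ˢ B)) :
    Z = σ '' Icc (sInf (paramSet σ Z)) (sSup (paramSet σ Z)) ∧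
    AEMeasurable (interpolant G t) (pairMeasure q A B) ∧
    AEMeasurable (linearParam σ Z)
      (((baryMeasure q).prod (baryMeasure q)).map (squareMap k m t)) ∧
    interpolatingMeasure q A B G t =
      ((n + 1 : ℝ≥0∞) ^ (k + m))⁻¹ •
        (((baryMeasure q).prod (baryMeasure q)).map (squareMap k m t)).map (linearParam σ Z) := by
  subst hA hB
  have hσg := hσu.1
  have hqi := vertex_mem_gasket q
  have hL0 := pathLength_pos_of_isRegularCommonPath hσ (mem_image_of_mem _ (hqi i))
    (mem_image_of_mem _ (hqi j)) hσg
  have hLtop : pathLength σ ≠ ∞ := hσ.1.2.1.ne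
  obtain ⟨L, hL⟩ : ∃ L : ℝ, pathLength σ = ENNReal.ofReal L :=
    ⟨_, (ENNReal.ofReal_toReal hLtop).symm⟩
  have hLpos : 0 < L := by
    rw [hL] at hL0
    exact ENNReal.ofReal_pos.1 (pos_iff_ne_zero.2 hL0)
  have hpos : ∀ x ∈ gasket q, ∀ y ∈ gasket q,
      t ∈ Icc (0 : ℝ) 1 ∧
      t + ((1 / 2) ^ m * t * (1 - q.coord j y) - (1 / 2) ^ k * (1 - t) * (1 - q.coord i x)) / L
        ∈ Icc (0 : ℝ) 1 ∧
      interpolant G t (wordMap q w x, wordMap q v y) =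
        σ (t + ((1 / 2) ^ m * t * (1 - q.coord j y) -
          (1 / 2) ^ k * (1 - t) * (1 - q.coord i x)) / L) := by
    intro x hx y hy
    obtain ⟨hg, t₁, t₂, hp⟩ := hG _ (mem_image_of_mem _ hx) _ (mem_image_of_mem _ hy)
    have ht' := hp.mem_Icc (mem_image_of_mem _ hx) (mem_image_of_mem _ hy) hg ht
    have h := hp.apply_eq hq hLpos hL hσg hx hy hg ht'
    rw [hw, hv] at h
    exact ⟨⟨hp.1.trans ht'.1, ht'.2.trans hp.2.2.1⟩, h⟩
  have ht01 : t ∈ Icc (0 : ℝ) 1 := (hpos _ (hqi i) _ (hqi j)).1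
  -- `α` and `α + δ` are the positions on `σ` for the values `0` and `1` of `ψ_t`; they turn out to
  -- be the endpoints of `I_t`.
  set α := t - (1 / 2) ^ k * (1 - t) / L with hα
  set δ := ((1 / 2) ^ k * (1 - t) + (1 / 2) ^ m * t) / L with hδ
  have hW := squareMap_weight_pos k m ht01
  have hδ0 : 0 < δ := div_pos hW hLpos
  have hfac : ∀ x ∈ gasket q, ∀ y ∈ gasket q,
      α + squareMap k m t (q.coord i x, q.coord j y) * δ ∈ Icc (0 : ℝ) 1 ∧
      interpolant G t (wordMap q w x, wordMap q v y) =
        σ (α + squareMap k m t (q.coord i x, q.coord j y) * δ) := by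
    intro x hx y hy
    have h := (hpos x hx y hy).2
    rwa [position_eq k m ht01] at h
  have hsurj : ∀ s ∈ Icc (0 : ℝ) 1, ∃ x ∈ gasket q, ∃ y ∈ gasket q,
      squareMap k m t (q.coord i x, q.coord j y) = s := by
    intro s hs
    obtain ⟨x, hx, hxs⟩ := exists_coord_eq (q := q) hn i hs
    -- On the antidiagonal, `ψ_t(s, 1 - s) = s`.
    obtain ⟨y, hy, hys⟩ := exists_coord_eq (q := q) hn j (s := 1 - s)
      ⟨sub_nonneg.2 hs.2, by linarith [hs.1]⟩
    refine ⟨x, hx, y, hy, ?_⟩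
    rw [hxs, hys, squareMap, div_eq_iff hW.ne']
    ring
  have hmem : ∀ s ∈ Icc (0 : ℝ) 1, α + s * δ ∈ Icc (0 : ℝ) 1 := by
    intro s hs
    obtain ⟨x, hx, y, hy, rfl⟩ := hsurj s hs
    exact (hfac x hx y hy).1
  have hα0 : 0 ≤ α := by simpa using (hmem 0 (by simp)).1
  have hαδ : α + δ ≤ 1 := by simpa using (hmem 1 (by simp)).2
  have hsub : Icc α (α + δ) ⊆ Icc 0 1 := Icc_subset_Icc hα0 hαδ
  have hZσ : Z = σ '' Icc α (α + δ) := by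
    rw [hZ]
    ext z
    constructor
    · rintro ⟨⟨_, _⟩, ⟨⟨x, hx, rfl⟩, ⟨y, hy, rfl⟩⟩, rfl⟩
      rw [(hfac x hx y hy).2]
      have hs := squareMap_mem_Icc k m ht01 (p := (q.coord i x, q.coord j y))
        ⟨coord_nonneg q hx i, coord_le_one q hx i⟩ ⟨coord_nonneg q hy j, coord_le_one q hy j⟩
      exact mem_image_of_mem _ ⟨by nlinarith [hs.1], by nlinarith [hs.2]⟩
    · rintro ⟨u, hu, rfl⟩
      obtain ⟨x, hx, y, hy, hs⟩ := hsurj ((u - α) / δ)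
        ⟨div_nonneg (sub_nonneg.2 hu.1) hδ0.le, (div_le_one hδ0).2 (by linarith [hu.2])⟩
      refine ⟨(wordMap q w x, wordMap q v y), ⟨mem_image_of_mem _ hx, mem_image_of_mem _ hy⟩, ?_⟩
      rw [(hfac x hx y hy).2, hs, div_mul_cancel₀ _ hδ0.ne', add_sub_cancel]
  -- Injectivity excludes further parameters of points of `Z`, so the infimum and supremum in
  -- `linearParam` are `α` and `α + δ`.
  have hinj : InjOn σ (Icc 0 1) := hσg.injOn hLpos (by rw [← hσg.2.2, hL])
  have hparam : paramSet σ Z = Icc α (α + δ) := by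
    ext s
    rw [paramSet, mem_ofPred_eq, hZσ]
    constructor
    · rintro ⟨hs, u, hu, hus⟩
      rwa [← hinj (hsub hu) hs hus]
    · exact fun hs => ⟨hsub hs, mem_image_of_mem _ hs⟩
  have hle : α ≤ α + δ := by linarith
  have hlin : linearParam σ Z = fun s => σ (α + s * δ) := by
    funext s
    rw [linearParam, hparam, csInf_Icc hle, csSup_Icc hle, add_sub_cancel_left]
  refine ⟨by rw [hparam, csInf_Icc hle, csSup_Icc hle]; exact hZσ, ?_⟩
  rw [hlin]
  exact interpolatingMeasure_eq_of_factor hn hw hv ht01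
    (hσg.1.1.comp (by fun_prop) hmem) fun x hx y hy => (hfac x hx y hy).2
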